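/- Let $m\ge n\ge 2$ with $(m,n)\neq(2,2)$, let $G_{m,n}=\langle x,y\mid x^m=y^n\rangle$, $Z_{m,n}=\mathbb Z_m*\mathbb Z_n=\langle X,Y\mid X^m=Y^n=1\rangle$, and let $\pi:G_{m,n}\to Z_{m,n}$ be given by $\pi(x)=X$, $\pi(y)=Y$. Put $\mathcal S=(s_1,s_2)$ with $s_1=xyx^{-m+1}$, $s_2=x^{m-1}y^{-1}$. An element of $G_{m,n}$ is $\sigma$-positive if it is represented by a word in $s_1^{\pm1},s_2^{\pm1}$ which either contains $s_1$ but not $s_1^{-1}$, or contains $s_2$ but none of $s_1,s_1^{-1},s_2^{-1}$. Write $g<_D h$ if $g^{-1}h$ is $\sigma$-positive. Let $T$ be the Bass–Serre tree of $Z_{m,n}$: its vertices are the cosets $gP=g\langle X\rangle$ and $gQ=g\langle Y\rangle$, and each $g\in Z_{m,n}$ is an edge joining $gP$ and $gQ$. Regard $T$ as a planar tree in which the edges at $gP$ are $g,gX,\dots,gX^{m-1}$ and the edges at $gQ$ are $g,gY,\dots,gY^{n-1}$, in positive cyclic order. This gives a cyclic order on the set $E(T)$ of ends, on which $Z_{m,n}$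 acts. An end is coded by $\pm l_1l_2\cdots$, where the ray from the midpoint of the edge $PQ$ passes first through $P$ (sign $+$) or $Q$ (sign $-$), and $l_k\ge1$ is the position, in positive cyclic order counted from the edge just traversed, of the edge along which the ray leaves its $k$-th vertex. A standard action consists of an embedding of $E(T)$ onto a closed subset of $S^1=\mathbb R/\mathbb Z$ respecting the cyclic orders, an action of $Z_{m,n}$ on $S^1$ by orientation-preserving homeomorphisms extending its action on $E(T)$, and a lift $\Theta:G_{m,n}\to\mathrm{Homeo}_+(\mathbb R)$ of this action (along $\pi$ and $\mathbb R\to\mathbb R/\mathbb Z$) for which $x^m=y^n$ acts as $t\mapsto t+1$. Fix a lift $O\in\mathbb R$ of the end $-111\cdots$; for $N\in\mathbb Z$ let $(N;\pm l_1l_2\cdots)\in\mathbb R$ be the lift of the end $\pm l_1l_2\cdots$ lying in $[O+N,O+N+1)$. Put $E=(0;-111\cdots)$ and $F=(0;+111\cdots)$, and write $g<_{\{E,F\}}h$ if $\Theta(g)E<\Theta(h)E$, or $\Theta(g)E=\Theta(h)E$ and $\Theta(g)F<\Theta(h)F$. Then standard actions exist; $\mathcal S$ generates $G_{m,n}$ and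 $<_D$ is a left ordering of $G_{m,n}$ (the Dehornoy-like ordering defined by $\mathcal S$); and for every standard action and every choice of $O$, the relation $<_{\{E,F\}}$ is a left ordering of $G_{m,n}$ and coincides with $<_D$. -/

import Mathlib

namespace DehornoyLike

/-! ### Left orderings and Dehornoy-like orderings -/

section Orderings

variable {G : Type*} [Group G]

/-- A left ordering of a group: a strict total order invariant under left multiplication. -/
structure IsLeftOrdering (lt : G → G → Prop) : Prop where
  irrefl : ∀ g, ¬ lt g g
  trans : ∀ g h k, lt g h → lt h k → lt g k
  total : ∀ g h, lt g h ∨ g = h ∨ lt h g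
  mul_left : ∀ h g g', lt g g' → lt (h * g) (h * g')

/-- The element represented by a word on `S ∪ S⁻¹`; the letter `(i, true)` stands for `S i` and
`(i, false)` for `(S i)⁻¹`. -/
def wordEval {k : ℕ} (S : Fin k → G) (w : List (Fin k × Bool)) : G :=
  (w.map fun p => if p.2 then S p.1 else (S p.1)⁻¹).prod

/-- A word is `i`-positive if it contains the letter `s_i` but none of
`s_j^{±1}` (`j < i`) and `s_i⁻¹`. -/
def IsPositiveWord {k : ℕ} (i : Fin k) (w : List (Fin k × Bool)) : Prop :=
  (i, true) ∈ w ∧ ∀ p ∈ w, i ≤ p.1 ∧ p ≠ (i, false)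

/-- The set of `σ(S)`-positive elements. -/
def sigmaPositive {k : ℕ} (S : Fin k → G) : Set G :=
  {g | ∃ i w, IsPositiveWord i w ∧ wordEval S w = g}

/-- The relation `h <_D g` given by `h⁻¹ g` being `σ(S)`-positive. -/
def dehornoyLT {k : ℕ} (S : Fin k → G) (h g : G) : Prop :=
  h⁻¹ * g ∈ sigmaPositive S

/-- `lt` is the Dehornoy-like ordering defined by the ordered finite generating set `S`. -/
structure IsDehornoyLike {k : ℕ} (S : Fin k → G) (lt : G → G → Prop) : Prop where
  generates : Subgroup.closure (Set.range S) = ⊤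
  isLeftOrdering : IsLeftOrdering lt
  positiveCone : {g | lt 1 g} = sigmaPositive S

/-- The relation on `G` defined by an action `Θ` on the real line and a finite sequence `x` of
points: compare the images of the first point of the sequence at which `g` and `g'` differ.
The group `ℝ ≃o ℝ` is the group of orientation-preserving homeomorphisms of the line. -/
def ltOfPoints (Θ : G →* (ℝ ≃o ℝ)) {k : ℕ} (x : Fin k → ℝ) (g g' : G) : Prop :=
  ∃ j, (∀ i < j, Θ g (x i) = Θ g' (x i)) ∧ Θ g (x j) < Θ g' (x j)

end Orderings

/-! ### The groups `G_{m,n}` and `ℤ_m * ℤ_n` -/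

/-- `G_{m,n} = ⟨x, y ∣ x ^ m = y ^ n⟩`. -/
abbrev Gmn (m n : ℕ) : Type :=
  PresentedGroup ({FreeGroup.of 0 ^ m * (FreeGroup.of 1 ^ n)⁻¹} : Set (FreeGroup (Fin 2)))

/-- The generator `x` of `G_{m,n}`. -/
def x (m n : ℕ) : Gmn m n := PresentedGroup.of 0

/-- The generator `y` of `G_{m,n}`. -/
def y (m n : ℕ) : Gmn m n := PresentedGroup.of 1

/-- The ordered generating set `s₁ = x y x^{-m+1}`, `s₂ = x^{m-1} y⁻¹`. -/
def S (m n : ℕ) : Fin 2 → Gmn m n :=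
  ![x m n * y m n * x m n ^ (-(m : ℤ) + 1), x m n ^ ((m : ℤ) - 1) * (y m n)⁻¹]

/-- `Z_{m,n} = ℤ_m * ℤ_n`. -/
abbrev Zmn (m n : ℕ) : Type :=
  Monoid.Coprod (Multiplicative (ZMod m)) (Multiplicative (ZMod n))

/-- The generator `X` of `ℤ_m`. -/
def X (m n : ℕ) : Zmn m n := Monoid.Coprod.inl (Multiplicative.ofAdd 1)

/-- The generator `Y` of `ℤ_n`. -/
def Y (m n : ℕ) : Zmn m n := Monoid.Coprod.inr (Multiplicative.ofAdd 1)

theorem X_pow (m n : ℕ) : X m n ^ m = 1 := by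
  rw [X, ← map_pow, ← ofAdd_nsmul]; simp

theorem Y_pow (m n : ℕ) : Y m n ^ n = 1 := by
  rw [Y, ← map_pow, ← ofAdd_nsmul]; simp

/-- The projection `π : G_{m,n} → Z_{m,n}` with `π x = X` and `π y = Y`. -/
def proj (m n : ℕ) : Gmn m n →* Zmn m n :=
  PresentedGroup.toGroup (f := ![X m n, Y m n]) (by simp [X_pow, Y_pow])

/-! ### The Bass-Serre tree and its ends -/

/-- The vertices of the Bass-Serre tree: cosets of `ℤ_m` and cosets of `ℤ_n`. -/
abbrev Vertex (m n : ℕ) : Type :=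
  (Zmn m n ⧸ Subgroup.zpowers (X m n)) ⊕ (Zmn m n ⧸ Subgroup.zpowers (Y m n))

/-- The letter `X` for `true`, the letter `Y` for `false`. -/
def letter (m n : ℕ) (b : Bool) : Zmn m n := if b then X m n else Y m n

/-- The order of a letter, which is the valence of the vertices of the corresponding type. -/
def valence (m n : ℕ) (b : Bool) : ℕ := if b then m else n

/-- The end point of the edge `g` of the given type: the coset `g ℤ_m` (the vertex `g P`) for
`true`, the coset `g ℤ_n` (the vertex `g Q`) for `false`. -/
def vert {m n : ℕ} (b : Bool) (g : Zmn m n) : Vertex m n :=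
  if b then Sum.inl (QuotientGroup.mk g) else Sum.inr (QuotientGroup.mk g)

/-- The Bass-Serre tree: the edge `g ∈ Z_{m,n}` joins `g ℤ_m` and `g ℤ_n`. -/
def tree (m n : ℕ) : SimpleGraph (Vertex m n) where
  Adj u v := ∃ (g : Zmn m n) (b : Bool), u = vert b g ∧ v = vert (!b) g
  symm := ⟨by
    rintro u v ⟨g, b, rfl, rfl⟩
    exact ⟨g, !b, rfl, by simp⟩⟩
  loopless := ⟨by
    rintro u ⟨g, b, rfl, h⟩
    cases b <;> simp [vert] at h⟩

/-- A ray: an infinite path without backtracking. -/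
structure Ray (m n : ℕ) where
  toFun : ℕ → Vertex m n
  adj : ∀ k, (tree m n).Adj (toFun k) (toFun (k + 1))
  reduced : ∀ k, toFun (k + 2) ≠ toFun k

/-- Two rays define the same end if they have a common tail. -/
def raySetoid (m n : ℕ) : Setoid (Ray m n) where
  r r s := ∃ a b, ∀ k, r.toFun (a + k) = s.toFun (b + k)
  iseqv :=
    { refl := fun _ => ⟨0, 0, fun _ => rfl⟩
      symm := fun ⟨a, b, h⟩ => ⟨b, a, fun k => (h k).symm⟩
      trans := by
        rintro r s t ⟨a, b, h⟩ ⟨c, d, h'⟩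
        refine ⟨a + c, d + b, fun k => ?_⟩
        have h1 := h (c + k)
        have h2 := h' (b + k)
        rw [show a + c + k = a + (c + k) by ring, h1, show d + b + k = d + (b + k) by ring, ← h2]
        congr 1
        ring }

/-- The set `E(T)` of ends of the tree. -/
def Ends (m n : ℕ) : Type := Quotient (raySetoid m n)

/-- The end of a ray. -/
def Ray.toEnd {m n : ℕ} (r : Ray m n) : Ends m n := Quotient.mk _ r

theorem smul_vert {m n : ℕ} (g h : Zmn m n) (b : Bool) : g • vert b h = vert b (g * h) := by
  cases b <;> rfl

/-- The translate of a ray by an element of `Z_{m,n}`. -/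
def Ray.smul {m n : ℕ} (g : Zmn m n) (r : Ray m n) : Ray m n where
  toFun k := g • r.toFun k
  adj k := by
    obtain ⟨h, b, h1, h2⟩ := r.adj k
    exact ⟨g * h, b, by rw [h1, smul_vert], by rw [h2, smul_vert]⟩
  reduced k h := r.reduced k (MulAction.injective g h)

/-- The action of `Z_{m,n}` on the ends of the tree. -/
def Ends.smul {m n : ℕ} (g : Zmn m n) : Ends m n → Ends m n :=
  Quotient.map (Ray.smul g) (by
    rintro r s ⟨a, b, h⟩
    exact ⟨a, b, fun k => congrArg (g • ·) (h k)⟩)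

/-- The cyclic order on the ends of the planar tree. The tree is embedded in the oriented plane so
that the edges around the vertex `g P` are `g, g X, g X², …, g X^{m-1}` and those around `g Q` are
`g, g Y, …, g Y^{n-1}`, in the positive cyclic order. Three distinct ends are joined by
a tripod, and are ordered as the three edges that leave the centre of the tripod. -/
def Ends.Cyc {m n : ℕ} (e₁ e₂ e₃ : Ends m n) : Prop :=
  ∃ (b : Bool) (g : Zmn m n) (j k : ℕ) (r₁ r₂ r₃ : Ray m n),
    0 < j ∧ j < k ∧ k < valence m n b ∧
    r₁.toEnd = e₁ ∧ r₂.toEnd = e₂ ∧ r₃.toEnd = e₃ ∧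
    r₁.toFun 0 = vert b g ∧ r₁.toFun 1 = vert (!b) g ∧
    r₂.toFun 0 = vert b g ∧ r₂.toFun 1 = vert (!b) (g * letter m n b ^ j) ∧
    r₃.toFun 0 = vert b g ∧ r₃.toFun 1 = vert (!b) (g * letter m n b ^ k)

/-! ### The coding of ends by sequences of labels -/

/-- A sequence `± l₁ l₂ l₃ …` of edge labels. The sign `+` (`true`) means that the ray from the
midpoint of the edge `PQ` passes first through `P`, the sign `-` that it passes first through `Q`;
at each vertex, the edges other than the one just traversed are labelled `1, 2, …` in the positive
cyclic order. The label `l_{k+1}` is `label k`. -/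
structure Code (m n : ℕ) where
  sign : Bool
  label : ℕ → ℕ
  pos : ∀ k, 0 < label k
  lt : ∀ k, label k < valence m n (xor sign k.bodd)

namespace Code

variable {m n : ℕ} (c : Code m n)

/-- The type of the vertex at which the label `label k` is read. -/
def side (k : ℕ) : Bool := xor c.sign k.bodd

/-- The edges traversed by the ray: `edge 0 = 1` is the edge `PQ`, and
`edge (k + 1) = edge k * X ^ label k` or `edge k * Y ^ label k` in turn. -/
def edge : ℕ → Zmn m n
  | 0 => 1
  | k + 1 => edge k * letter m n (c.side k) ^ c.label k

theorem side_succ (k : ℕ) : c.side (k + 1) = !c.side k := by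
  simp [side, Nat.bodd_succ]

theorem vert_mul_pow (b : Bool) (g : Zmn m n) (l : ℕ) :
    vert b (g * letter m n b ^ l) = vert b g := by
  cases b
  · exact congrArg Sum.inr (QuotientGroup.eq.2 (by
      rw [mul_inv_rev, mul_assoc, inv_mul_cancel, mul_one]
      exact inv_mem (pow_mem (Subgroup.mem_zpowers _) l)))
  · exact congrArg Sum.inl (QuotientGroup.eq.2 (by
      rw [mul_inv_rev, mul_assoc, inv_mul_cancel, mul_one]
      exact inv_mem (pow_mem (Subgroup.mem_zpowers _) l)))

theorem vert_ne (b : Bool) (g : Zmn m n) {l : ℕ} (h0 : 0 < l) (h : l < valence m n b) :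
    vert (!b) (g * letter m n b ^ l) ≠ vert (!b) g := by
  intro he
  cases b
  · have h1 := QuotientGroup.eq.1 (Sum.inl_injective he)
    rw [mul_inv_rev, mul_assoc, inv_mul_cancel, mul_one] at h1
    obtain ⟨z, hz⟩ := h1
    have h2 := congrArg (Monoid.Coprod.snd (M := Multiplicative (ZMod m))) hz
    simp only [letter, X, Y, map_zpow, map_inv, map_pow, Monoid.Coprod.snd_apply_inl,
      Monoid.Coprod.snd_apply_inr, one_zpow, Bool.false_eq_true, if_false] at h2
    have h3 := inv_eq_one.1 h2.symm
    rw [← ofAdd_nsmul, ofAdd_eq_one, nsmul_one, ZMod.natCast_eq_zero_iff] at h3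
    exact absurd (Nat.le_of_dvd h0 h3) (not_le.2 h)
  · have h1 := QuotientGroup.eq.1 (Sum.inr_injective he)
    rw [mul_inv_rev, mul_assoc, inv_mul_cancel, mul_one] at h1
    obtain ⟨z, hz⟩ := h1
    have h2 := congrArg (Monoid.Coprod.fst (N := Multiplicative (ZMod n))) hz
    simp only [letter, X, Y, map_zpow, map_inv, map_pow, Monoid.Coprod.fst_apply_inl,
      Monoid.Coprod.fst_apply_inr, one_zpow, if_true] at h2
    have h3 := inv_eq_one.1 h2.symm
    rw [← ofAdd_nsmul, ofAdd_eq_one, nsmul_one, ZMod.natCast_eq_zero_iff] at h3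
    exact absurd (Nat.le_of_dvd h0 h3) (not_le.2 h)

/-- The ray with the given labels, extended backwards from the midpoint of `PQ` to a vertex; its
`k`-th step is the edge `edge k`. -/
def ray : Ray m n where
  toFun k := vert (!c.side k) (c.edge k)
  adj k := ⟨c.edge k, !c.side k, rfl, by
    rw [side_succ, Bool.not_not]
    exact vert_mul_pow _ _ _⟩
  reduced k := by
    have h1 : vert (!c.side (k + 2)) (c.edge (k + 2)) = vert (!c.side k) (c.edge (k + 1)) := by
      have h2 : (!c.side (k + 2)) = c.side (k + 1) := by rw [c.side_succ (k + 1), Bool.not_not]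
      rw [h2, c.side_succ k, ← c.side_succ k]
      exact vert_mul_pow _ _ _
    rw [h1]
    exact vert_ne _ _ (c.pos k) (c.lt k)

/-- The end with the given labels. -/
def toEnd : Ends m n := c.ray.toEnd

/-- The sequence `± 1 1 1 …`. -/
def ones (hm : 2 ≤ m) (hn : 2 ≤ n) (s : Bool) : Code m n where
  sign := s
  label _ := 1
  pos _ := one_pos
  lt k := by
    cases xor s k.bodd
    · exact hn
    · exact hm

end Code

/-! ### The standard action -/

/-- A standard action of `G_{m,n}` on the real line. It consists of
* an embedding `ι` of the set of ends of the planar tree into the circle `ℝ / ℤ` that respects the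
  cyclic orders and has closed image (equivalently, which is a topological embedding of the Cantor
  set of ends, compatible with the planar structure);
* an action `ρ` of `Z_{m,n}` on the circle by orientation-preserving homeomorphisms that extends
  the action on the ends;
* the lift `Θ` of `ρ` to an action of `G_{m,n}` on the universal cover `ℝ`, for which the central
  element `x ^ m = y ^ n` acts as the positive generator `t ↦ t + 1` of the deck group. -/
structure StandardAction (m n : ℕ) where
  ι : Ends m n → AddCircle (1 : ℝ)
  injective : Function.Injective ι
  sbtw_of_cyc : ∀ e₁ e₂ e₃, Ends.Cyc e₁ e₂ e₃ → sbtw (ι e₁) (ι e₂) (ι e₃)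
  isClosed_range : IsClosed (Set.range ι)
  ρ : Zmn m n →* (AddCircle (1 : ℝ) ≃ₜ AddCircle (1 : ℝ))
  sbtw_map : ∀ g a b c, sbtw a b c → sbtw (ρ g a) (ρ g b) (ρ g c)
  extends_ends : ∀ g e, ρ g (ι e) = ι (Ends.smul g e)
  Θ : Gmn m n →* (ℝ ≃o ℝ)
  lift : ∀ (g : Gmn m n) (t : ℝ),
    ((Θ g t : ℝ) : AddCircle (1 : ℝ)) = ρ (proj m n g) (t : AddCircle (1 : ℝ))
  central : ∀ t : ℝ, Θ (x m n ^ m) t = t + 1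

/-- The point `(N; ± l₁ l₂ …)` of the preimage of the set of ends in `ℝ`: the lift of the end
`± l₁ l₂ …` in the fundamental domain `[O + N, O + N + 1)`. The origin `O` is to be a lift of the
end `- 1 1 1 …`, so that `O = (0; - 1 1 1 …)`. -/
noncomputable def StandardAction.point {m n : ℕ} (A : StandardAction m n) (O : ℝ) (N : ℤ)
    (c : Code m n) : ℝ :=
  AddCircle.equivIco 1 (O + N) (A.ι c.toEnd)

end DehornoyLike

/-!
Put `a = s₁` and `b = s₂`, so that `a b = x` and `b y = x ^ (m - 1)`. Since `x ^ m = y ^ n` is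
central, every element of `G_{m,n}` is `x ^ p u b ^ r` with `u` a product of syllables
`y ^ j x ^ (-i)`, where `0 < j < n` and `0 < i < m`. Such a `u` lies in the monoid generated by
`a`, `b`, `b⁻¹`, and so does `u⁻¹ x ^ q` for `q > 0`; hence the element (if `p ≥ 0`) or its inverse
(if `p < 0`) lies in this monoid, and every `g` is `σ`-positive, trivial, or the inverse of a
`σ`-positive element. In a standard action `s₂` fixes `E`, `s₁` moves `E` to the right, and `s₂`
moves `F` to the right, the last because `(m, n) ≠ (2, 2)`. So `σ`-positive elements are
`>_{E,F} 1`, and by the trichotomy the two relations coincide and are left orderings.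

For existence, let `x` act on the line by `t ↦ t + 1 / m` and `y` by a conjugate of
`t ↦ t + 1 / n` such that, on the circle, the nontrivial powers of `x` and of `y` play ping-pong on
two complementary arcs. The end with labels `l₁ l₂ ⋯` goes to the point with that itinerary, which
is a convergent series in the labels because the inverse branches can be chosen affine.
-/

namespace DehornoyLike

/-! ### Trichotomy for `σ`-positive elements -/

section Trichotomy

variable {G : Type*} [Group G] {m n : ℕ} {x y a b : G}

theorem pow_mem_center (hxy : x ^ m = y ^ n) (hgen : Subgroup.closure {x, y} = ⊤) :
    x ^ m ∈ Subgroup.center G := by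
  rw [← Subgroup.centralizer_univ, ← Subgroup.coe_top, ← hgen, Subgroup.centralizer_closure,
    Subgroup.mem_centralizer_iff]
  rintro h (rfl | rfl)
  · exact (Commute.refl _).pow_right m
  · rw [hxy]
    exact (Commute.refl _).pow_right n

/-- The submonoid generated by the syllables `y ^ j x ^ (-i)` with `0 < j < n` and `0 < i < m`: up
to powers of `x` on the left and of `b = x ^ (m - 1) y⁻¹` on the right, it exhausts the group. -/
def syllables (x y : G) (m n : ℕ) : Submonoid G :=
  Submonoid.closure {s | ∃ i j, 0 < i ∧ i < m ∧ 0 < j ∧ j < n ∧ s = y ^ j * (x ^ i)⁻¹}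

/-- The elements of the form `x ^ p u b ^ r` with `u` a product of syllables. -/
def normalForms (x y b : G) (m n : ℕ) : Set G :=
  {g | ∃ p : ℤ, ∃ u ∈ syllables x y m n, ∃ r : ℤ, x ^ p * u * b ^ r = g}

theorem syllable_mul_mem {i j : ℕ} {u : G} (hi : 0 < i) (him : i < m) (hj : 0 < j) (hjn : j < n)
    (hu : u ∈ syllables x y m n) : y ^ j * (x ^ i)⁻¹ * u ∈ syllables x y m n :=
  mul_mem (Submonoid.subset_closure ⟨i, j, hi, him, hj, hjn, rfl⟩) hu

theorem exists_syllable_mul_eq (hm : 2 ≤ m) (hn : 2 ≤ n) (hb : b * y = x ^ (m - 1)) {u : G}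
    (hu : u ∈ syllables x y m n) (r : ℤ) :
    ∃ i j, 0 < i ∧ i < m ∧ 0 < j ∧ j < n ∧ ∃ v ∈ syllables x y m n, ∃ r' : ℤ,
      u * b ^ r = y ^ j * (x ^ i)⁻¹ * v * b ^ r' := by
  induction hu using Submonoid.closure_induction_left with
  | one =>
    refine ⟨m - 1, 1, by omega, by omega, one_pos, hn, 1, one_mem _, r + 1, ?_⟩
    rw [← hb, zpow_add_one, ((Commute.refl b).zpow_left r).eq]
    group
  | mul_left s hs v hv _ =>
    obtain ⟨i, j, hi, him, hj, hjn, rfl⟩ := hs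
    exact ⟨i, j, hi, him, hj, hjn, v, hv, r, rfl⟩

theorem zpow_mul_mem_normalForms {g : G} (hg : g ∈ normalForms x y b m n) (p : ℤ) :
    x ^ p * g ∈ normalForms x y b m n := by
  obtain ⟨q, u, hu, r, rfl⟩ := hg
  exact ⟨p + q, u, hu, r, by rw [zpow_add]; simp only [mul_assoc]⟩

theorem y_mul_mem_normalForms (hm : 2 ≤ m) (hn : 2 ≤ n) (hxy : x ^ m = y ^ n)
    (hgen : Subgroup.closure {x, y} = ⊤) (hb : b * y = x ^ (m - 1)) {g : G}
    (hg : g ∈ normalForms x y b m n) : y * g ∈ normalForms x y b m n := by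
  obtain ⟨p, u, hu, r, rfl⟩ := hg
  obtain ⟨q, i, him, rfl⟩ : ∃ q : ℤ, ∃ i < m, p = m * q + -(i : ℤ) := by
    have hpos := Int.emod_nonneg (-p) (show (m : ℤ) ≠ 0 by omega)
    have hlt := Int.emod_lt_of_pos (-p) (show (0 : ℤ) < m by omega)
    refine ⟨-(-p / m), (-p % m).toNat, by omega, ?_⟩
    linarith [Int.toNat_of_nonneg hpos, Int.mul_ediv_add_emod (-p) m]
  have hcomm : y * x ^ (m * q : ℤ) = x ^ (m * q : ℤ) * y := by
    rw [zpow_mul, zpow_natCast]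
    exact Subgroup.mem_center_iff.1 (zpow_mem (pow_mem_center hxy hgen) q) y
  have hmove : y * (x ^ (m * q + -(i : ℤ)) * u * b ^ r) =
      x ^ (m * q : ℤ) * (y * (x ^ i)⁻¹ * u * b ^ r) := by
    rw [zpow_add, zpow_neg, zpow_natCast]
    simp only [← mul_assoc, hcomm]
  rw [hmove]
  apply zpow_mul_mem_normalForms
  rcases i.eq_zero_or_pos with rfl | hi
  -- If `i = 0`, then `y` is absorbed by the first syllable of `u b ^ r`, which exists even for
  -- `u = 1` because `1 = y x ^ (-(m - 1)) b`.
  · obtain ⟨i, j, hi, him, _, hjn, v, hv, r', h⟩ := exists_syllable_mul_eq hm hn hb hu r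
    have hy : y * (x ^ 0)⁻¹ * u * b ^ r = y ^ (j + 1) * (x ^ i)⁻¹ * v * b ^ r' := by
      rw [pow_zero, inv_one, mul_one, mul_assoc, h, pow_succ']
      simp only [mul_assoc]
    rw [hy]
    rcases (Nat.succ_le_of_lt hjn).eq_or_lt with hj' | hj'
    · refine ⟨m - i, v, hv, r', ?_⟩
      rw [show j + 1 = n from hj', ← hxy, zpow_sub, zpow_natCast, zpow_natCast]
    · exact ⟨0, _, syllable_mul_mem hi him j.succ_pos hj' hv, r', by rw [zpow_zero, one_mul]⟩
  · exact ⟨0, _, syllable_mul_mem hi him one_pos hn hu, r, by rw [zpow_zero, one_mul, pow_one]⟩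

theorem normalForms_eq_univ (hm : 2 ≤ m) (hn : 2 ≤ n) (hxy : x ^ m = y ^ n)
    (hgen : Subgroup.closure {x, y} = ⊤) (hb : b * y = x ^ (m - 1)) :
    normalForms x y b m n = Set.univ := by
  have hpow : ∀ (j : ℕ) {g}, g ∈ normalForms x y b m n → y ^ j * g ∈ normalForms x y b m n := by
    intro j g hg
    induction j with
    | zero => rwa [pow_zero, one_mul]
    | succ j ih =>
      rw [pow_succ', mul_assoc]
      exact y_mul_mem_normalForms hm hn hxy hgen hb ih
  have hyinv : y⁻¹ = x ^ (-m : ℤ) * y ^ (n - 1) := by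
    rw [zpow_neg, zpow_natCast, hxy, eq_inv_mul_iff_mul_eq, mul_inv_eq_iff_eq_mul, ← pow_succ,
      Nat.sub_add_cancel (by omega)]
  refine Set.eq_univ_of_forall fun g => ?_
  have hg : g ∈ Subgroup.closure {x, y} := hgen ▸ Subgroup.mem_top g
  induction hg using Subgroup.closure_induction_left with
  | one => exact ⟨0, 1, one_mem _, 0, by simp⟩
  | mul_left s hs g _ hg =>
    rcases hs with rfl | rfl
    · simpa only [zpow_one] using zpow_mul_mem_normalForms hg 1
    · exact y_mul_mem_normalForms hm hn hxy hgen hb hg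
  | inv_mul_cancel s hs g _ hg =>
    rcases hs with rfl | rfl
    · simpa only [zpow_neg_one] using zpow_mul_mem_normalForms hg (-1)
    · rw [hyinv, mul_assoc]
      exact zpow_mul_mem_normalForms (hpow _ hg) _

section SigmaMonoid

variable {M : Submonoid G} (hx : x ∈ M) (hbM : b⁻¹ ∈ M)

include hx hbM

theorem y_mem_of_x_mem (hb : b * y = x ^ (m - 1)) : y ∈ M := by
  rw [eq_inv_mul_of_mul_eq hb]
  exact mul_mem hbM (pow_mem hx _)

theorem syllable_mem (hb : b * y = x ^ (m - 1)) {i j : ℕ} (hi : i < m) (hj : 0 < j) :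
    y ^ j * (x ^ i)⁻¹ ∈ M := by
  have h : y ^ j * (x ^ i)⁻¹ = y ^ (j - 1) * b⁻¹ * x ^ (m - 1 - i) := by
    rw [pow_sub x (show i ≤ m - 1 by omega), ← hb, ← pow_sub_one_mul hj.ne']
    group
  rw [h]
  exact mul_mem (mul_mem (pow_mem (y_mem_of_x_mem hx hbM hb) _) hbM) (pow_mem hx _)

theorem syllables_le (hb : b * y = x ^ (m - 1)) : syllables x y m n ≤ M := by
  rw [syllables, Submonoid.closure_le]
  rintro _ ⟨i, j, _, hi, hj, _, rfl⟩
  exact syllable_mem hx hbM hb hi hj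

theorem inv_mul_pow_mem (hm : 2 ≤ m) (hxy : x ^ m = y ^ n) (hb : b * y = x ^ (m - 1)) {u : G}
    (hu : u ∈ syllables x y m n) {p : ℕ} (hp : 0 < p) : u⁻¹ * x ^ p ∈ M := by
  induction hu using Submonoid.closure_induction_left generalizing p with
  | one => simpa only [inv_one, one_mul] using pow_mem hx p
  | mul_left s hs v _ ih =>
    obtain ⟨i, j, hi, _, _, hjn, rfl⟩ := hs
    -- `x ^ i y ^ (-j) x = x ^ i y ^ (n - j) x ^ (-(m - 1))`: up to powers of `x`, the inverse of a
    -- syllable is again a syllable.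
    have hy : (y ^ j)⁻¹ * x ^ m = y ^ (n - j) := by
      rw [hxy, inv_mul_eq_iff_eq_mul, ← pow_add, Nat.add_sub_cancel' hjn.le]
    have h : (y ^ j * (x ^ i)⁻¹ * v)⁻¹ * x ^ p =
        v⁻¹ * x ^ i * (y ^ (n - j) * (x ^ (m - 1))⁻¹ * x ^ (p - 1)) := by
      rw [← hy, ← pow_sub_one_mul (show m ≠ 0 by omega), ← pow_sub_one_mul hp.ne']
      group
    rw [h]
    exact mul_mem (ih hi) (mul_mem (syllable_mem hx hbM hb (by omega) (by omega)) (pow_mem hx _))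

end SigmaMonoid

theorem mem_or_inv_mem (hm : 2 ≤ m) (hn : 2 ≤ n) (hxy : x ^ m = y ^ n)
    (hgen : Subgroup.closure {x, y} = ⊤) (hab : a * b = x) (hb : b * y = x ^ (m - 1)) (g : G) :
    g ∈ Submonoid.closure {a, b, b⁻¹} ∨ g⁻¹ ∈ Submonoid.closure {a, b, b⁻¹} := by
  set M := Submonoid.closure {a, b, b⁻¹}
  have hbM : b ∈ M := Submonoid.subset_closure (by simp)
  have hbM' : b⁻¹ ∈ M := Submonoid.subset_closure (by simp)
  have hx : x ∈ M := hab ▸ mul_mem (Submonoid.subset_closure (by simp)) hbM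
  have hr : ∀ r : ℤ, b ^ r ∈ M := by
    rintro (r | r)
    · simpa only [Int.ofNat_eq_natCast, zpow_natCast] using pow_mem hbM r
    · simpa only [zpow_negSucc, inv_pow] using pow_mem hbM' (r + 1)
  have hg : g ∈ normalForms x y b m n := normalForms_eq_univ hm hn hxy hgen hb ▸ Set.mem_univ g
  obtain ⟨p, u, hu, r, rfl⟩ := hg
  obtain ⟨p, rfl⟩ | ⟨p, hp, rfl⟩ : (∃ q : ℕ, p = q) ∨ ∃ q : ℕ, 0 < q ∧ p = -q := by
    rcases le_or_gt 0 p with h | h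
    · exact Or.inl ⟨p.toNat, by omega⟩
    · exact Or.inr ⟨(-p).toNat, by omega, by omega⟩
  · left
    rw [zpow_natCast]
    exact mul_mem (mul_mem (pow_mem hx p) (syllables_le hx hbM' hb hu)) (hr r)
  · right
    have h : (x ^ (-p : ℤ) * u * b ^ r)⁻¹ = b ^ (-r) * (u⁻¹ * x ^ p) := by
      rw [zpow_neg, zpow_natCast, zpow_neg]
      group
    rw [h]
    exact mul_mem (hr _) (inv_mul_pow_mem hx hbM' hm hxy hb hu hp)

end Trichotomy

section Words

variable {G : Type*} [Group G] {k : ℕ} (S : Fin k → G)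

theorem wordEval_nil : wordEval S [] = 1 :=
  rfl

theorem wordEval_cons (p : Fin k × Bool) (w : List (Fin k × Bool)) :
    wordEval S (p :: w) = wordEval S [p] * wordEval S w := by
  simp [wordEval]

theorem wordEval_singleton (i : Fin k) (b : Bool) :
    wordEval S [(i, b)] = if b then S i else (S i)⁻¹ := by
  simp [wordEval]

theorem wordEval_mem {H : Subgroup G} {w : List (Fin k × Bool)} (hw : ∀ p ∈ w, S p.1 ∈ H) :
    wordEval S w ∈ H := by
  refine list_prod_mem fun g hg => ?_
  obtain ⟨p, hp, rfl⟩ := List.mem_map.1 hg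
  split
  · exact hw p hp
  · exact inv_mem (hw p hp)

theorem exists_wordEval_eq (S : Fin 2 → G) {g : G}
    (hg : g ∈ Submonoid.closure {S 0, S 1, (S 1)⁻¹}) :
    ∃ w, (0, false) ∉ w ∧ wordEval S w = g := by
  induction hg using Submonoid.closure_induction_left with
  | one => exact ⟨[], List.not_mem_nil, rfl⟩
  | mul_left s hs g _ ih =>
    obtain ⟨w, hw, rfl⟩ := ih
    obtain ⟨p, hp, rfl⟩ : ∃ p, (0, false) ≠ p ∧ wordEval S [p] = s := by
      rcases hs with rfl | rfl | rfl
      exacts [⟨(0, true), by simp, wordEval_singleton S _ _⟩,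
        ⟨(1, true), by simp, wordEval_singleton S _ _⟩,
        ⟨(1, false), by simp, wordEval_singleton S _ _⟩]
    exact ⟨p :: w, by simp [hp, hw], wordEval_cons S p w⟩

theorem pow_mem_sigmaPositive (i : Fin k) {r : ℕ} (hr : 0 < r) : S i ^ r ∈ sigmaPositive S := by
  refine ⟨i, List.replicate r (i, true), ⟨by simp [hr.ne'], fun p hp => ?_⟩, by simp [wordEval]⟩
  rw [List.eq_of_mem_replicate hp]
  simp

theorem trichotomy_of_mem_zpowers (i : Fin k) {g : G} (hg : g ∈ Subgroup.zpowers (S i)) :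
    g ∈ sigmaPositive S ∨ g = 1 ∨ g⁻¹ ∈ sigmaPositive S := by
  obtain ⟨r, rfl⟩ := Subgroup.mem_zpowers_iff.1 hg
  obtain ⟨r, rfl | rfl⟩ := Int.eq_nat_or_neg r <;> rcases r.eq_zero_or_pos with rfl | hr
  · simp
  · exact Or.inl (by simpa using pow_mem_sigmaPositive S i hr)
  · simp
  · exact Or.inr (Or.inr (by simpa using pow_mem_sigmaPositive S i hr))

theorem trichotomy_of_mem_closure (S : Fin 2 → G) {g : G}
    (hg : g ∈ Submonoid.closure {S 0, S 1, (S 1)⁻¹}) :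
    g ∈ sigmaPositive S ∨ g = 1 ∨ g⁻¹ ∈ sigmaPositive S := by
  obtain ⟨w, hw, rfl⟩ := exists_wordEval_eq S hg
  by_cases hpos : ((0, true) : Fin 2 × Bool) ∈ w
  · exact Or.inl ⟨0, w, ⟨hpos, fun p hp => ⟨Fin.zero_le _, fun h => hw (h ▸ hp)⟩⟩, rfl⟩
  · refine trichotomy_of_mem_zpowers S 1 (wordEval_mem S fun ⟨i, s⟩ hp => ?_)
    obtain rfl | rfl : i = 0 ∨ i = 1 := by omega
    · cases s <;> contradiction
    · exact Subgroup.mem_zpowers _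

end Words

section Presentation

variable (m n : ℕ)

theorem x_pow_eq_y_pow : x m n ^ m = y m n ^ n := by
  have h : PresentedGroup.mk ({FreeGroup.of 0 ^ m * (FreeGroup.of 1 ^ n)⁻¹} :
      Set (FreeGroup (Fin 2))) (FreeGroup.of 0 ^ m * (FreeGroup.of 1 ^ n)⁻¹) = 1 :=
    PresentedGroup.one_of_mem rfl
  rwa [map_mul, map_inv, map_pow, map_pow, mul_inv_eq_one] at h

theorem closure_x_y : Subgroup.closure {x m n, y m n} = ⊤ := by
  rw [← PresentedGroup.closure_range_of]
  congr 1
  ext g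
  simp [x, y, eq_comm]

theorem S_zero_mul_S_one : S m n 0 * S m n 1 = x m n := by
  simp only [S, Matrix.cons_val_zero, Matrix.cons_val_one, Matrix.cons_val_fin_one]
  group

variable {m} in
theorem S_one_mul_y (hm : 0 < m) : S m n 1 * y m n = x m n ^ (m - 1) := by
  simp only [S, Matrix.cons_val_one, Matrix.cons_val_fin_one, inv_mul_cancel_right]
  rw [← zpow_natCast (x m n), Nat.cast_sub hm, Nat.cast_one]

variable {m n}

theorem closure_S (hm : 0 < m) : Subgroup.closure (Set.range (S m n)) = ⊤ := by
  have hS : ∀ i, S m n i ∈ Subgroup.closure (Set.range (S m n)) := fun i =>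
    Subgroup.subset_closure (Set.mem_range_self i)
  have hx : x m n ∈ Subgroup.closure (Set.range (S m n)) :=
    S_zero_mul_S_one m n ▸ mul_mem (hS 0) (hS 1)
  rw [eq_top_iff, ← closure_x_y, Subgroup.closure_le]
  rintro g (rfl | rfl)
  · exact hx
  · rw [eq_inv_mul_of_mul_eq (S_one_mul_y n hm)]
    exact mul_mem (inv_mem (hS 1)) (pow_mem hx _)

theorem sigmaPositive_trichotomy (hm : 2 ≤ m) (hn : 2 ≤ n) (g : Gmn m n) :
    g ∈ sigmaPositive (S m n) ∨ g = 1 ∨ g⁻¹ ∈ sigmaPositive (S m n) := by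
  rcases mem_or_inv_mem hm hn (x_pow_eq_y_pow m n) (closure_x_y m n) (S_zero_mul_S_one m n)
    (S_one_mul_y n (by omega)) g with h | h
  · exact trichotomy_of_mem_closure _ h
  · have hinv := trichotomy_of_mem_closure _ h
    rw [inv_inv, inv_eq_one] at hinv
    tauto

end Presentation

section LtOfPoints

variable {G : Type*} [Group G] (Θ : G →* (ℝ ≃o ℝ))

theorem action_mul (g h : G) (t : ℝ) : Θ (g * h) t = Θ g (Θ h t) := by
  rw [map_mul]
  rfl

theorem action_one (t : ℝ) : Θ 1 t = t := by
  rw [map_one]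
  rfl

theorem action_inv_apply (g : G) (t : ℝ) : Θ g⁻¹ (Θ g t) = t := by
  rw [← action_mul, inv_mul_cancel, action_one]

theorem action_inv_eq {g : G} {s t : ℝ} (h : Θ g s = t) : Θ g⁻¹ t = s :=
  h ▸ action_inv_apply Θ g s

section Relation

variable {k : ℕ} (p : Fin k → ℝ)

theorem ltOfPoints_mul_left (h g g' : G) (hg : ltOfPoints Θ p g g') :
    ltOfPoints Θ p (h * g) (h * g') := by
  obtain ⟨j, heq, hlt⟩ := hg
  exact ⟨j, fun i hi => by rw [action_mul, action_mul, heq i hi],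
    by rw [action_mul, action_mul]; exact (Θ h).strictMono hlt⟩

theorem ltOfPoints_irrefl (g : G) : ¬ ltOfPoints Θ p g g :=
  fun ⟨_, _, h⟩ => lt_irrefl _ h

theorem ltOfPoints_trans (g h l : G) (hgh : ltOfPoints Θ p g h) (hhl : ltOfPoints Θ p h l) :
    ltOfPoints Θ p g l := by
  obtain ⟨i, hi, hi'⟩ := hgh
  obtain ⟨j, hj, hj'⟩ := hhl
  rcases lt_trichotomy i j with hij | rfl | hij
  · exact ⟨i, fun a ha => (hi a ha).trans (hj a (ha.trans hij)), hi'.trans_eq (hj i hij)⟩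
  · exact ⟨i, fun a ha => (hi a ha).trans (hj a ha), hi'.trans hj'⟩
  · exact ⟨j, fun a ha => (hi a (ha.trans hij)).trans (hj a ha), (hi j hij).trans_lt hj'⟩

variable {l : ℕ} {S : Fin l → G}

theorem ltOfPoints_iff_dehornoyLT
    (htri : ∀ g, g ∈ sigmaPositive S ∨ g = 1 ∨ g⁻¹ ∈ sigmaPositive S)
    (hpos : ∀ g ∈ sigmaPositive S, ltOfPoints Θ p 1 g) (g h : G) :
    ltOfPoints Θ p g h ↔ dehornoyLT S g h := by
  constructor
  · intro hgh
    have hlt : ltOfPoints Θ p 1 (g⁻¹ * h) := by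
      simpa only [inv_mul_cancel] using ltOfPoints_mul_left Θ p g⁻¹ _ _ hgh
    rcases htri (g⁻¹ * h) with hmem | hone | hinv
    · exact hmem
    · exact absurd (hone ▸ hlt) (ltOfPoints_irrefl Θ p 1)
    · have hgt := ltOfPoints_mul_left Θ p (g⁻¹ * h) _ _ (hpos _ hinv)
      rw [mul_one, mul_inv_cancel] at hgt
      exact absurd (ltOfPoints_trans Θ p _ _ _ hlt hgt) (ltOfPoints_irrefl Θ p 1)
  · intro hgh
    simpa only [mul_one, mul_inv_cancel_left] using ltOfPoints_mul_left Θ p g _ _ (hpos _ hgh)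

theorem isLeftOrdering_ltOfPoints
    (htri : ∀ g, g ∈ sigmaPositive S ∨ g = 1 ∨ g⁻¹ ∈ sigmaPositive S)
    (hpos : ∀ g ∈ sigmaPositive S, ltOfPoints Θ p 1 g) : IsLeftOrdering (ltOfPoints Θ p) where
  irrefl := ltOfPoints_irrefl Θ p
  trans := ltOfPoints_trans Θ p
  mul_left := ltOfPoints_mul_left Θ p
  total g h := by
    simp only [ltOfPoints_iff_dehornoyLT Θ p htri hpos, dehornoyLT]
    rcases htri (g⁻¹ * h) with hmem | hone | hinv
    · exact Or.inl hmem
    · exact Or.inr (Or.inl (inv_mul_eq_one.1 hone))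
    · exact Or.inr (Or.inr (by rwa [mul_inv_rev, inv_inv] at hinv))

end Relation

section WordAction

variable {k : ℕ} {S : Fin k → G} {t : ℝ} {w : List (Fin k × Bool)}

theorem le_wordEval_apply (hw : ∀ p ∈ w, t ≤ Θ (wordEval S [p]) t) : t ≤ Θ (wordEval S w) t := by
  induction w with
  | nil => rw [wordEval_nil, action_one]
  | cons p w ih =>
    rw [wordEval_cons, action_mul]
    exact (hw p List.mem_cons_self).trans
      ((Θ _).monotone (ih fun q hq => hw q (List.mem_cons_of_mem p hq)))

theorem lt_wordEval_apply (hw : ∀ p ∈ w, t ≤ Θ (wordEval S [p]) t) {q : Fin k × Bool}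
    (hq : q ∈ w) (hlt : t < Θ (wordEval S [q]) t) : t < Θ (wordEval S w) t := by
  induction w with
  | nil => exact absurd hq List.not_mem_nil
  | cons p w ih =>
    have hw' : ∀ p ∈ w, t ≤ Θ (wordEval S [p]) t := fun q hq => hw q (List.mem_cons_of_mem p hq)
    rw [wordEval_cons, action_mul]
    rcases List.mem_cons.1 hq with rfl | hq
    · exact hlt.trans_le ((Θ _).monotone (le_wordEval_apply Θ hw'))
    · exact (hw p List.mem_cons_self).trans_lt ((Θ _).strictMono (ih hw' hq))

theorem wordEval_apply_eq (hw : ∀ p ∈ w, Θ (wordEval S [p]) t = t) : Θ (wordEval S w) t = t := by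
  induction w with
  | nil => rw [wordEval_nil, action_one]
  | cons p w ih =>
    rw [wordEval_cons, action_mul, ih fun q hq => hw q (List.mem_cons_of_mem p hq),
      hw p List.mem_cons_self]

end WordAction

theorem ltOfPoints_one_of_mem_sigmaPositive {S : Fin 2 → G} {E F : ℝ} (h0 : E < Θ (S 0) E)
    (h1 : Θ (S 1) E = E) (hF : F < Θ (S 1) F) {g : G} (hg : g ∈ sigmaPositive S) :
    ltOfPoints Θ ![E, F] 1 g := by
  obtain ⟨i, w, ⟨hi, hw⟩, rfl⟩ := hg
  obtain rfl | rfl : i = 0 ∨ i = 1 := by omega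
  · have hlt : E < Θ (wordEval S w) E := by
      refine lt_wordEval_apply Θ (fun ⟨i, b⟩ hp => ?_) hi (by simpa [wordEval] using h0)
      have hne := (hw _ hp).2
      obtain rfl | rfl : i = 0 ∨ i = 1 := by omega
      · cases b
        · exact absurd rfl hne
        · simpa [wordEval] using h0.le
      · cases b
        · simpa [wordEval] using (action_inv_eq Θ h1).ge
        · simpa [wordEval] using h1.ge
    exact ⟨0, fun i hi => absurd hi (Fin.not_lt_zero i), by simpa [action_one] using hlt⟩
  · have hS : ∀ p ∈ w, wordEval S [p] = S 1 := by
      rintro ⟨i, b⟩ hp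
      obtain ⟨hle, hne⟩ := hw _ hp
      obtain rfl : i = 1 := le_antisymm (Fin.le_last i) hle
      cases b
      · exact absurd rfl hne
      · simp [wordEval]
    have hE : Θ (wordEval S w) E = E := wordEval_apply_eq Θ fun p hp => by rw [hS p hp, h1]
    have hlt : F < Θ (wordEval S w) F :=
      lt_wordEval_apply Θ (fun p hp => by rw [hS p hp]; exact hF.le) hi (by rwa [hS _ hi])
    refine ⟨1, fun i hi => ?_, by simpa [action_one] using hlt⟩
    obtain rfl : i = 0 := Fin.lt_one_iff i |>.1 hi
    simpa [action_one] using hE.symm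

end LtOfPoints

/-! ### The points `E` and `F` of a standard action -/

namespace Code

variable {m n : ℕ} (hm : 2 ≤ m) (hn : 2 ≤ n) (s : Bool) (k : ℕ)

theorem side_ones : (ones hm hn (!s)).side k = (ones hm hn s).side (k + 1) := by
  rw [side_succ]
  cases s <;> simp [side, ones]

theorem letter_mul_edge_ones :
    letter m n s * (ones hm hn (!s)).edge k = (ones hm hn s).edge (k + 1) := by
  induction k with
  | zero => simp [edge, ones, side]
  | succ k ih =>
    rw [edge, ← mul_assoc, ih, edge, side_ones]
    rfl

theorem letter_smul_ones :
    Ends.smul (letter m n s) (ones hm hn (!s)).toEnd = (ones hm hn s).toEnd := by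
  refine Quotient.sound ⟨0, 1, fun k => ?_⟩
  change letter m n s • vert _ _ = vert _ _
  rw [smul_vert, letter_mul_edge_ones, side_ones, zero_add, add_comm 1 k]

end Code

theorem proj_x (m n : ℕ) : proj m n (x m n) = letter m n true := by
  simp [proj, x, letter]

theorem proj_y (m n : ℕ) : proj m n (y m n) = letter m n false := by
  simp [proj, y, letter]

theorem strictMono_action_pow {G : Type*} [Group G] {Θ : G →* (ℝ ≃o ℝ)} {g : G} {k : ℕ}
    (h : ∀ t, Θ (g ^ k) t = t + 1) (t : ℝ) : StrictMono fun j => Θ (g ^ j) t := by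
  have hlt : ∀ t, t < Θ g t := by
    intro t
    by_contra! hle
    have hpow : ∀ j, Θ (g ^ j) t ≤ t := by
      intro j
      induction j with
      | zero => rw [pow_zero, action_one]
      | succ j ih =>
        rw [pow_succ', action_mul]
        exact ((Θ g).monotone ih).trans hle
    linarith [hpow k, h t]
  refine strictMono_nat_of_lt_succ fun j => ?_
  rw [pow_succ', action_mul]
  exact hlt _

theorem action_mem_Ioo {G : Type*} [Group G] {Θ : G →* (ℝ ≃o ℝ)} {g : G} {k : ℕ}
    (h : ∀ t, Θ (g ^ k) t = t + 1) (hk : 1 < k) (t : ℝ) : Θ g t ∈ Set.Ioo t (t + 1) := by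
  have hpow := strictMono_action_pow h t
  constructor
  · simpa only [pow_zero, pow_one, action_one] using hpow one_pos
  · simpa only [h, pow_one] using hpow hk

namespace StandardAction

variable {m n : ℕ} (A : StandardAction m n)

theorem central_y (t : ℝ) : A.Θ (y m n ^ n) t = t + 1 := by
  rw [← x_pow_eq_y_pow]
  exact A.central t

theorem map_add_one (g : Gmn m n) (t : ℝ) : A.Θ g (t + 1) = A.Θ g t + 1 := by
  have hcenter := pow_mem_center (x_pow_eq_y_pow m n) (closure_x_y m n)
  rw [← A.central t, ← A.central, ← action_mul, ← action_mul, Subgroup.mem_center_iff.1 hcenter]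

theorem S_one_apply (hm : 0 < m) {s t : ℝ} (h : A.Θ (y m n) (A.Θ (x m n) s) = t + 1) :
    A.Θ (S m n 1) t = s := by
  have hx : A.Θ (x m n ^ (m - 1)) (A.Θ (x m n) s) = s + 1 := by
    rw [← action_mul, ← pow_succ, Nat.sub_add_cancel hm, A.central]
  rw [← S_one_mul_y n hm, action_mul, h, A.map_add_one] at hx
  exact add_right_cancel hx

theorem coe_point (O : ℝ) (N : ℤ) (c : Code m n) :
    (A.point O N c : AddCircle (1 : ℝ)) = A.ι c.toEnd :=
  (AddCircle.equivIco (1 : ℝ) (O + N)).symm_apply_apply _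

theorem point_mem_Ico (O : ℝ) (N : ℤ) (c : Code m n) :
    A.point O N c ∈ Set.Ico (O + N) (O + N + 1) :=
  (AddCircle.equivIco (1 : ℝ) (O + N) (A.ι c.toEnd)).2

section Points

variable {A} {hm : 2 ≤ m} {hn : 2 ≤ n} {E F : ℝ}
  (hE : (E : AddCircle (1 : ℝ)) = A.ι (Code.ones hm hn false).toEnd)
  (hF : (F : AddCircle (1 : ℝ)) = A.ι (Code.ones hm hn true).toEnd)
  (hFE : F ∈ Set.Ico E (E + 1))

include hE hF hFE

theorem x_apply_E : A.Θ (x m n) E = F := by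
  have hmem := Set.Ioo_subset_Ico_self (action_mem_Ioo A.central hm E)
  refine (AddCircle.coe_eq_coe_iff_of_mem_Ico hmem hFE).1 ?_
  rw [A.lift, proj_x, hE, A.extends_ends, hF, ← Code.letter_smul_ones hm hn true, Bool.not_true]

theorem E_lt_F : E < F :=
  x_apply_E hE hF hFE ▸ (action_mem_Ioo A.central hm E).1

theorem y_apply_F : A.Θ (y m n) F = E + 1 := by
  have hmem := Set.Ioo_subset_Ico_self (action_mem_Ioo A.central_y hn F)
  have hE1 : E + 1 < F + 1 := add_lt_add_left (E_lt_F hE hF hFE) 1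
  refine (AddCircle.coe_eq_coe_iff_of_mem_Ico hmem ⟨hFE.2.le, hE1⟩).1 ?_
  rw [A.lift, proj_y, hF, A.extends_ends, AddCircle.coe_add_period, hE,
    ← Code.letter_smul_ones hm hn false, Bool.not_false]

theorem S_one_apply_E : A.Θ (S m n 1) E = E :=
  A.S_one_apply (by omega) (by rw [x_apply_E hE hF hFE, y_apply_F hE hF hFE])

theorem S_zero_apply_E : A.Θ (S m n 0) E = F := by
  have h : A.Θ (S m n 0) (A.Θ (S m n 1) E) = F := by
    rw [← action_mul, S_zero_mul_S_one, x_apply_E hE hF hFE]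
  rwa [S_one_apply_E hE hF hFE] at h

theorem y_x_apply_F_lt (h : 3 ≤ m ∨ 3 ≤ n) : A.Θ (y m n) (A.Θ (x m n) F) < F + 1 := by
  have hxE := x_apply_E hE hF hFE
  have hyF := y_apply_F hE hF hFE
  have hx_pow := strictMono_action_pow A.central E
  have hy_pow := strictMono_action_pow A.central_y F
  have hxF : A.Θ (x m n) F = A.Θ (x m n ^ 2) E := by rw [pow_two, action_mul, hxE]
  have hyE : A.Θ (y m n) (E + 1) = A.Θ (y m n ^ 2) F := by rw [pow_two, action_mul, hyF]
  have hxF_le : A.Θ (x m n) F ≤ E + 1 := by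
    rw [hxF, ← A.central]
    exact hx_pow.monotone hm
  have hyE_le : A.Θ (y m n) (E + 1) ≤ F + 1 := by
    rw [hyE, ← A.central_y]
    exact hy_pow.monotone hn
  rcases h with hm | hn
  · have hlt : A.Θ (x m n) F < E + 1 := by
      rw [hxF, ← A.central]
      exact hx_pow hm
    exact ((A.Θ (y m n)).strictMono hlt).trans_le hyE_le
  · have hlt : A.Θ (y m n) (E + 1) < F + 1 := by
      rw [hyE, ← A.central_y]
      exact hy_pow hn
    exact ((A.Θ (y m n)).monotone hxF_le).trans_lt hlt

theorem lt_S_one_apply_F (h : 3 ≤ m ∨ 3 ≤ n) : F < A.Θ (S m n 1) F := by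
  calc F = A.Θ (S m n 1) (A.Θ (y m n) (A.Θ (x m n) F) - 1) :=
        (A.S_one_apply (by omega) (sub_add_cancel _ _).symm).symm
    _ < A.Θ (S m n 1) F :=
        (A.Θ (S m n 1)).strictMono (sub_lt_iff_lt_add.2 (y_x_apply_F_lt hE hF hFE h))

theorem ltOfPoints_one_of_sigmaPositive (h : 3 ≤ m ∨ 3 ≤ n) {g : Gmn m n}
    (hg : g ∈ sigmaPositive (S m n)) : ltOfPoints A.Θ ![E, F] 1 g :=
  ltOfPoints_one_of_mem_sigmaPositive A.Θ
    ((E_lt_F hE hF hFE).trans_eq (S_zero_apply_E hE hF hFE).symm) (S_one_apply_E hE hF hFE)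
    (lt_S_one_apply_F hE hF hFE h) hg

end Points

theorem point_ones_false {hm : 2 ≤ m} {hn : 2 ≤ n} {O : ℝ}
    (hO : (O : AddCircle (1 : ℝ)) = A.ι (Code.ones hm hn false).toEnd) :
    A.point O 0 (Code.ones hm hn false) = O := by
  refine (AddCircle.coe_eq_coe_iff_of_mem_Ico (A.point_mem_Ico O 0 _) ?_).1
    ((A.coe_point O 0 _).trans hO.symm)
  simp

theorem isLeftOrdering_and_iff_dehornoyLT {hm : 2 ≤ m} {hn : 2 ≤ n} (h : 3 ≤ m ∨ 3 ≤ n) {O : ℝ}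
    (hO : (O : AddCircle (1 : ℝ)) = A.ι (Code.ones hm hn false).toEnd) :
    let p := ![A.point O 0 (Code.ones hm hn false), A.point O 0 (Code.ones hm hn true)]
    IsLeftOrdering (ltOfPoints A.Θ p) ∧
      ∀ g g', ltOfPoints A.Θ p g g' ↔ dehornoyLT (S m n) g g' := by
  have hF := A.point_mem_Ico O 0 (Code.ones hm hn true)
  rw [Int.cast_zero, add_zero] at hF
  rw [point_ones_false A hO]
  have hpos : ∀ g ∈ sigmaPositive (S m n),
      ltOfPoints A.Θ ![O, A.point O 0 (Code.ones hm hn true)] 1 g := fun g hg =>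
    ltOfPoints_one_of_sigmaPositive hO (A.coe_point _ _ _) hF h hg
  have htri := sigmaPositive_trichotomy hm hn
  exact ⟨isLeftOrdering_ltOfPoints _ _ htri hpos, ltOfPoints_iff_dehornoyLT _ _ htri hpos⟩

end StandardAction

/-! ### The ping-pong action on the line -/

section Circle

/-- The homeomorphism of `ℝ / ℤ` induced by a homeomorphism of `ℝ` commuting with `t ↦ t + 1`. -/
noncomputable def circleHom : CircleDeg1Liftˣ →* (AddCircle (1 : ℝ) ≃ₜ AddCircle (1 : ℝ)) :=
  let circleMap (f : CircleDeg1Liftˣ) : AddCircle (1 : ℝ) → AddCircle (1 : ℝ) :=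
    Function.Periodic.lift (f := fun t => ((f t : ℝ) : AddCircle (1 : ℝ))) (c := 1) fun t => by
      simp only [CircleDeg1Lift.map_add_one, AddCircle.coe_add_period]
  have circleMap_mul (f g z) : circleMap (f * g) z = circleMap f (circleMap g z) :=
    QuotientAddGroup.induction_on z fun _ => rfl
  have circleMap_one (z) : circleMap 1 z = z := QuotientAddGroup.induction_on z fun _ => rfl
  have continuous_circleMap (f) : Continuous (circleMap f) :=
    continuous_coinduced_dom.2
      ((AddCircle.continuous_mk' 1).comp (CircleDeg1Lift.toOrderIso f).continuous)
  { toFun := fun f =>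
      { toFun := circleMap f
        invFun := circleMap f⁻¹
        left_inv := fun z => by rw [← circleMap_mul, inv_mul_cancel, circleMap_one]
        right_inv := fun z => by rw [← circleMap_mul, mul_inv_cancel, circleMap_one]
        continuous_toFun := continuous_circleMap f
        continuous_invFun := continuous_circleMap f⁻¹ }
    map_one' := Homeomorph.ext circleMap_one
    map_mul' := fun f g => Homeomorph.ext (circleMap_mul f g) }

theorem circleHom_coe (f : CircleDeg1Liftˣ) (t : ℝ) :
    circleHom f (t : AddCircle (1 : ℝ)) = ((f t : ℝ) : AddCircle (1 : ℝ)) :=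
  rfl

theorem sbtw_coe_of_lt {a b c : ℝ} (hab : a < b) (hbc : b < c) (hca : c < a + 1) :
    sbtw (a : AddCircle (1 : ℝ)) (b : AddCircle (1 : ℝ)) (c : AddCircle (1 : ℝ)) := by
  rw [sbtw_iff_not_btw]
  change ¬ btw ((c : ℝ ⧸ AddSubgroup.zmultiples (1 : ℝ))) b a
  rw [QuotientAddGroup.btw_coe_iff, not_le,
    (toIocMod_eq_iff _ (c := a + 1)).2 ⟨⟨by linarith, by linarith⟩, -1, by simp⟩,
    (toIcoMod_eq_iff _ (c := b + 1)).2 ⟨⟨by linarith, by linarith⟩, -1, by simp⟩]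
  linarith

theorem exists_lt_of_sbtw {u v w : AddCircle (1 : ℝ)} (h : sbtw u v w) :
    ∃ a b c : ℝ, a < b ∧ b < c ∧ c < a + 1 ∧ (a : AddCircle (1 : ℝ)) = u ∧
      (b : AddCircle (1 : ℝ)) = v ∧ (c : AddCircle (1 : ℝ)) = w := by
  obtain ⟨a, rfl⟩ := QuotientAddGroup.mk_surjective u
  obtain ⟨b, rfl⟩ := QuotientAddGroup.mk_surjective v
  obtain ⟨c, rfl⟩ := QuotientAddGroup.mk_surjective w
  rw [sbtw_iff_not_btw] at h
  change ¬ btw ((c : ℝ ⧸ AddSubgroup.zmultiples (1 : ℝ))) b a at h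
  rw [QuotientAddGroup.btw_coe_iff, not_le] at h
  have ha := toIocMod_mem_Ioc (one_pos : (0 : ℝ) < 1) c a
  have hb := toIcoMod_mem_Ico (one_pos : (0 : ℝ) < 1) c b
  refine ⟨toIocMod one_pos c a, toIcoMod one_pos c b, c + 1, h, hb.2, by linarith [ha.1], ?_, ?_,
    AddCircle.coe_add_period _ _⟩
  · rw [← sub_eq_zero, ← QuotientAddGroup.mk_sub, AddCircle.coe_eq_zero_iff]
    exact ⟨-toIocDiv one_pos c a, by rw [← toIocMod_sub_self]⟩
  · rw [← sub_eq_zero, ← QuotientAddGroup.mk_sub, AddCircle.coe_eq_zero_iff]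
    exact ⟨-toIcoDiv one_pos c b, by rw [← toIcoMod_sub_self]⟩

theorem sbtw_circleHom (f : CircleDeg1Liftˣ) {u v w : AddCircle (1 : ℝ)} (h : sbtw u v w) :
    sbtw (circleHom f u) (circleHom f v) (circleHom f w) := by
  obtain ⟨a, b, c, hab, hbc, hca, rfl, rfl, rfl⟩ := exists_lt_of_sbtw h
  have hf : StrictMono f := (CircleDeg1Lift.toOrderIso f).strictMono
  simp only [circleHom_coe]
  refine sbtw_coe_of_lt (hf hab) (hf hbc) ?_
  rw [← CircleDeg1Lift.map_add_one]
  exact hf hca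

end Circle

section PeriodicExtension

/-- The extension of a map of `[0, 1]` fixing both end points to a degree one map of the line. -/
noncomputable def periodicExtension (f : ℝ ≃o ℝ) (h0 : f 0 = 0) (h1 : f 1 = 1) :
    CircleDeg1Lift where
  toFun t := ⌊t⌋ + f (Int.fract t)
  monotone' s t hst := by
    dsimp only
    rcases (Int.floor_le_floor hst).eq_or_lt with h | h
    · rw [h]
      gcongr
      simpa only [Int.fract, h, sub_le_sub_iff_right] using hst
    · have h' : (⌊s⌋ : ℝ) + 1 ≤ ⌊t⌋ := by exact_mod_cast h
      have hs : f (Int.fract s) ≤ 1 := h1 ▸ f.monotone (Int.fract_lt_one s).le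
      have ht : 0 ≤ f (Int.fract t) := h0 ▸ f.monotone (Int.fract_nonneg t)
      linarith
  map_add_one' t := by
    simp only [Int.floor_add_one, Int.fract_add_one, Int.cast_add, Int.cast_one]
    ring

theorem periodicExtension_of_mem {f : ℝ ≃o ℝ} (h0 : f 0 = 0) (h1 : f 1 = 1) {t : ℝ}
    (ht : t ∈ Set.Ico (0 : ℝ) 1) : periodicExtension f h0 h1 t = f t := by
  change (⌊t⌋ : ℝ) + f (Int.fract t) = f t
  rw [Int.floor_eq_zero_iff.2 ht, Int.fract_eq_self.2 ht, Int.cast_zero, zero_add]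

theorem periodicExtension_mul {f g : ℝ ≃o ℝ} {f0 : f 0 = 0} {f1 : f 1 = 1} {g0 : g 0 = 0}
    {g1 : g 1 = 1} (hfg : ∀ t, f (g t) = t) :
    periodicExtension f f0 f1 * periodicExtension g g0 g1 = 1 := by
  ext t
  have hmem : g (Int.fract t) ∈ Set.Ico (0 : ℝ) 1 :=
    ⟨g0 ▸ g.monotone (Int.fract_nonneg t), g1 ▸ g.strictMono (Int.fract_lt_one t)⟩
  change (⌊⌊t⌋ + g (Int.fract t)⌋ : ℝ) + f (Int.fract (⌊t⌋ + g (Int.fract t))) = t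
  rw [Int.floor_intCast_add, Int.fract_intCast_add, Int.floor_eq_zero_iff.2 hmem,
    Int.fract_eq_self.2 hmem, hfg, add_zero, Int.floor_add_fract]

/-- `periodicExtension` as an invertible map. -/
noncomputable def periodicExtensionUnit (f : ℝ ≃o ℝ) (h0 : f 0 = 0) (h1 : f 1 = 1) :
    CircleDeg1Liftˣ where
  val := periodicExtension f h0 h1
  inv := periodicExtension f.symm (by simp [OrderIso.symm_apply_eq, h0])
    (by simp [OrderIso.symm_apply_eq, h1])
  val_inv := periodicExtension_mul f.apply_symm_apply
  inv_val := periodicExtension_mul f.symm_apply_apply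

end PeriodicExtension

section Kink

/-- The piecewise linear map of the line with a single break, at `a`, that maps `0, a, 1` to
`0, c, 1`. -/
noncomputable def kink (a c t : ℝ) : ℝ :=
  c + c / a * min (t - a) 0 + (1 - c) / (1 - a) * max (t - a) 0

variable {a c t : ℝ}

theorem kink_of_le (ha : a ≠ 0) (h : t ≤ a) : kink a c t = c / a * t := by
  rw [kink, min_eq_left (sub_nonpos.2 h), max_eq_right (sub_nonpos.2 h)]
  field_simp
  ring

theorem kink_of_ge (h : a ≤ t) : kink a c t = c + (1 - c) / (1 - a) * (t - a) := by
  rw [kink, min_eq_right (sub_nonneg.2 h), max_eq_left (sub_nonneg.2 h), mul_zero, add_zero]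

theorem kink_monotone (ha : a ∈ Set.Ioo (0 : ℝ) 1) (hc : c ∈ Set.Ioo (0 : ℝ) 1) :
    Monotone (kink a c) := by
  have h₁ : 0 ≤ c / a := (div_pos hc.1 ha.1).le
  have h₂ : 0 ≤ (1 - c) / (1 - a) := (div_pos (sub_pos.2 hc.2) (sub_pos.2 ha.2)).le
  intro s t hst
  unfold kink
  gcongr

theorem kink_kink (ha : a ∈ Set.Ioo (0 : ℝ) 1) (hc : c ∈ Set.Ioo (0 : ℝ) 1) :
    kink c a (kink a c t) = t := by
  have h₁ := ha.1.ne'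
  have h₂ := hc.1.ne'
  have h₃ := (sub_pos.2 ha.2).ne'
  have h₄ := (sub_pos.2 hc.2).ne'
  have hcenter : kink a c a = c := by simp [kink]
  rcases le_total t a with h | h
  · have hle : kink a c t ≤ c := (kink_monotone ha hc h).trans_eq hcenter
    rw [kink_of_le h₂ hle, kink_of_le h₁ h]
    field_simp
  · have hge : c ≤ kink a c t := hcenter.symm.trans_le (kink_monotone ha hc h)
    rw [kink_of_ge hge, kink_of_ge h]
    field_simp
    ring

/-- `kink` as an order isomorphism, with inverse the kink from `c` to `a`. -/
noncomputable def kinkIso (ha : a ∈ Set.Ioo (0 : ℝ) 1) (hc : c ∈ Set.Ioo (0 : ℝ) 1) : ℝ ≃o ℝ :=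
  Equiv.toOrderIso ⟨kink a c, kink c a, fun _ => kink_kink ha hc, fun _ => kink_kink hc ha⟩
    (kink_monotone ha hc) (kink_monotone hc ha)

theorem kinkIso_zero (ha : a ∈ Set.Ioo (0 : ℝ) 1) (hc : c ∈ Set.Ioo (0 : ℝ) 1) :
    kinkIso ha hc 0 = 0 :=
  (kink_of_le ha.1.ne' ha.1.le).trans (mul_zero _)

theorem kinkIso_one (ha : a ∈ Set.Ioo (0 : ℝ) 1) (hc : c ∈ Set.Ioo (0 : ℝ) 1) :
    kinkIso ha hc 1 = 1 := by
  refine (kink_of_ge ha.2.le).trans ?_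
  rw [div_mul_cancel₀ _ (sub_pos.2 ha.2).ne', add_sub_cancel]

end Kink

section Generators

variable {m n : ℕ}

theorem one_div_mem_Ioo (hn : 2 ≤ n) : (1 / n : ℝ) ∈ Set.Ioo (0 : ℝ) 1 := by
  have h : (1 : ℝ) < n := by exact_mod_cast hn
  exact ⟨by positivity, (div_lt_one (by positivity)).2 h⟩

theorem div_add_one_mem_Ioo (hm : 0 < m) : (m / (m + 1) : ℝ) ∈ Set.Ioo (0 : ℝ) 1 :=
  ⟨by positivity, (div_lt_one (by positivity)).2 (lt_add_one _)⟩

/-- The change of coordinates that carries the translation by `1 / n` to the action of `y`; it maps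
`0, 1 / n, 1` to `0, m / (m + 1), 1`. -/
noncomputable def bend (hm : 2 ≤ m) (hn : 2 ≤ n) : CircleDeg1Liftˣ :=
  let a := one_div_mem_Ioo hn
  let c := div_add_one_mem_Ioo (two_pos.trans_le hm)
  periodicExtensionUnit (kinkIso a c) (kinkIso_zero a c) (kinkIso_one a c)

theorem bend_of_le (hm : 2 ≤ m) (hn : 2 ≤ n) {t : ℝ} (h0 : 0 ≤ t) (h : t ≤ 1 / n) :
    bend hm hn t = m / (m + 1) / (1 / n) * t :=
  (periodicExtension_of_mem (kinkIso_zero ..) (kinkIso_one ..)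
    ⟨h0, h.trans_lt (one_div_mem_Ioo hn).2⟩).trans
    (kink_of_le (one_div_mem_Ioo hn).1.ne' h)

theorem bend_of_ge (hm : 2 ≤ m) (hn : 2 ≤ n) {t : ℝ} (h : 1 / n ≤ t) (h1 : t < 1) :
    bend hm hn t = m / (m + 1) + (1 - m / (m + 1)) / (1 - 1 / n) * (t - 1 / n) :=
  (periodicExtension_of_mem (kinkIso_zero ..) (kinkIso_one ..)
    ⟨(one_div_mem_Ioo hn).1.le.trans h, h1⟩).trans (kink_of_ge h)

/-- The homeomorphisms by which `x` (for `true`) and `y` (for `false`) act on the line: `x` is the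
translation by `1 / m`, and `y` is conjugate to the translation by `1 / n`, in such a way that
`y, …, y ^ (n - 1)` map `[0, m / (m + 1)]` into `[m / (m + 1), 1]`. -/
noncomputable def generator (hm : 2 ≤ m) (hn : 2 ≤ n) (b : Bool) : CircleDeg1Liftˣ :=
  if b then CircleDeg1Lift.translate (.ofAdd (1 / m))
  else bend hm hn * CircleDeg1Lift.translate (.ofAdd (1 / n)) * (bend hm hn)⁻¹

theorem generator_pow_valence (hm : 2 ≤ m) (hn : 2 ≤ n) (b : Bool) :
    generator hm hn b ^ valence m n b = CircleDeg1Lift.translate (.ofAdd 1) := by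
  have hm' : (m : ℝ) ≠ 0 := by positivity
  have hn' : (n : ℝ) ≠ 0 := by positivity
  cases b
  · simp only [generator, valence, Bool.false_eq_true, if_false, conj_pow,
      CircleDeg1Lift.translate_pow, mul_one_div_cancel hn', mul_inv_eq_iff_eq_mul]
    ext t
    simp only [Units.val_mul, CircleDeg1Lift.mul_apply, CircleDeg1Lift.translate_apply,
      CircleDeg1Lift.map_one_add]
  · simp only [generator, valence, if_true, CircleDeg1Lift.translate_pow, mul_one_div_cancel hm']

theorem generator_true_pow_apply (hm : 2 ≤ m) (hn : 2 ≤ n) (l : ℕ) (t : ℝ) :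
    (generator hm hn true ^ l) t = l / m + t := by
  simp only [generator, if_true, CircleDeg1Lift.translate_pow, CircleDeg1Lift.translate_apply,
    mul_one_div]

theorem generator_false_pow_apply (hm : 2 ≤ m) (hn : 2 ≤ n) {l : ℕ} (hl : 0 < l) (hl' : l < n)
    {u : ℝ} (hu : u ∈ Set.Ioo (0 : ℝ) 1) :
    (generator hm hn false ^ l) (m / (m + 1) * u) =
      m / (m + 1) + 1 / (m + 1) * ((l - 1 + u) / (n - 1)) := by
  have h1l : (1 : ℝ) ≤ l := by exact_mod_cast hl
  have hln : (l : ℝ) + 1 ≤ n := by exact_mod_cast hl'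
  have hn' : (n : ℝ) - 1 ≠ 0 := by linarith
  have hn₀ : (0 : ℝ) < n := by positivity
  have h_left : bend hm hn (u / n) = m / (m + 1) * u := by
    rw [bend_of_le hm hn (div_nonneg hu.1.le hn₀.le) (by gcongr; exact hu.2.le)]
    field_simp
  have h_right : bend hm hn ((l + u) / n) =
      m / (m + 1) + 1 / (m + 1) * ((l - 1 + u) / (n - 1)) := by
    rw [bend_of_ge hm hn (by gcongr; linarith [hu.1]) ((div_lt_one hn₀).2 (by linarith [hu.2]))]
    field_simp
    ring
  simp only [generator, Bool.false_eq_true, if_false, conj_pow, CircleDeg1Lift.translate_pow,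
    Units.val_mul, CircleDeg1Lift.mul_apply, CircleDeg1Lift.translate_apply]
  rw [← h_left, CircleDeg1Lift.units_inv_apply_apply, mul_one_div, ← add_div, h_right]

end Generators

section Coord

/-- The inverse branches `u ↦ digit b l + ratio b * u`, where `0 < l < valence b`, map `(0, 1)` to
disjoint subintervals of `(0, 1)`, in the order of their labels `l`. In suitable affine coordinates
they are the maps `x ^ l` and `y ^ l` modulo `1`. -/
noncomputable def digit (m n : ℕ) (b : Bool) (l : ℕ) : ℝ :=
  if b then (l - 1) / m + l / m ^ 2 else (l - 1) / (n - 1)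

/-- The slope of the inverse branches with constant terms `digit`. -/
noncomputable def ratio (m n : ℕ) (b : Bool) : ℝ := if b then 1 / m else 1 / (n - 1)

/-- The slope of a composition of `k` inverse branches of alternating types. -/
noncomputable def weight (m n : ℕ) (b : Bool) (k : ℕ) : ℝ :=
  ∏ i ∈ Finset.range k, ratio m n (xor b i.bodd)

/-- The point of `(0, 1)` coded by a sequence of labels: the limit of the compositions of the
corresponding inverse branches. -/
noncomputable def coord (m n : ℕ) (b : Bool) (l : ℕ → ℕ) : ℝ :=
  ∑' k, weight m n b k * digit m n (xor b k.bodd) (l k)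

/-- The label sequences of the codes with the given sign. -/
def admissible (m n : ℕ) (b : Bool) : Set (ℕ → ℕ) :=
  {l | ∀ k, 0 < l k ∧ l k < valence m n (xor b k.bodd)}

variable {m n : ℕ}

theorem tail_mem_admissible {b : Bool} {l : ℕ → ℕ} (hl : l ∈ admissible m n b) :
    (fun k => l (k + 1)) ∈ admissible m n (!b) := by
  intro k
  have := hl (k + 1)
  rwa [Nat.bodd_succ, Bool.xor_not, ← Bool.not_xor] at this

theorem isCompact_admissible (m n : ℕ) (b : Bool) : IsCompact (admissible m n b) := by
  have : admissible m n b = Set.univ.pi fun k => Set.Ioo 0 (valence m n (xor b k.bodd)) := by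
    ext l; simp [admissible]
  rw [this]
  exact isCompact_univ_pi fun k => (Set.finite_Ioo _ _).isCompact

theorem ratio_pos (hm : 2 ≤ m) (hn : 2 ≤ n) (b : Bool) : 0 < ratio m n b := by
  have hn' : (0 : ℝ) < n - 1 := sub_pos.2 (by exact_mod_cast hn)
  cases b <;> simp only [ratio, Bool.false_eq_true, if_false, if_true] <;> positivity

theorem digit_nonneg (hn : 2 ≤ n) (b : Bool) {l : ℕ} (hl : 0 < l) : 0 ≤ digit m n b l := by
  have hn' : (0 : ℝ) < n - 1 := sub_pos.2 (by exact_mod_cast hn)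
  have hl' : (0 : ℝ) ≤ l - 1 := sub_nonneg.2 (by exact_mod_cast hl)
  cases b <;> simp only [digit, Bool.false_eq_true, if_false, if_true] <;> positivity

theorem digit_true_pos (hm : 2 ≤ m) {l : ℕ} (hl : 0 < l) : 0 < digit m n true l := by
  have hl' : (0 : ℝ) ≤ l - 1 := sub_nonneg.2 (by exact_mod_cast hl)
  simp only [digit, if_true]
  positivity

theorem digit_true_add_ratio_lt_one (hm : 2 ≤ m) {l : ℕ} (hl : l < m) :
    digit m n true l + ratio m n true < 1 := by
  have hl' : (l : ℝ) ≤ m - 1 := le_sub_right_of_add_le (by exact_mod_cast hl)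
  calc digit m n true l + ratio m n true = l * (m + 1) / m ^ 2 := by
        simp only [digit, ratio, if_true]; field_simp; ring
    _ ≤ (m - 1) * (m + 1) / m ^ 2 := by gcongr
    _ < 1 := by rw [div_lt_one (by positivity)]; linarith

theorem digit_add_ratio_le_one (hm : 2 ≤ m) (hn : 2 ≤ n) (b : Bool) {l : ℕ}
    (hl : l < valence m n b) : digit m n b l + ratio m n b ≤ 1 := by
  cases b
  · have hn' : (0 : ℝ) < n - 1 := sub_pos.2 (by exact_mod_cast hn)
    have hl' : (l : ℝ) + 1 ≤ n := by exact_mod_cast hl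
    simp only [digit, ratio, Bool.false_eq_true, if_false]
    rw [← add_div, div_le_one hn']
    linarith
  · exact (digit_true_add_ratio_lt_one hm hl).le

theorem digit_add_ratio_le_digit (hn : 2 ≤ n) (b : Bool) {l l' : ℕ} (h : l < l') :
    digit m n b l + ratio m n b ≤ digit m n b l' := by
  have hn' : (0 : ℝ) < n - 1 := sub_pos.2 (by exact_mod_cast hn)
  have h' : (l : ℝ) + 1 ≤ l' := by exact_mod_cast h
  cases b <;> simp only [digit, ratio, Bool.false_eq_true, if_false, if_true]
  · rw [← add_div]
    gcongr
    linarith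
  · rw [add_right_comm, ← add_div]
    gcongr
    all_goals linarith

theorem weight_succ (b : Bool) (k : ℕ) :
    weight m n b (k + 1) = ratio m n b * weight m n (!b) k := by
  rw [weight, Finset.prod_range_succ', mul_comm, Nat.bodd_zero, Bool.xor_false, weight]
  simp only [Nat.bodd_succ, Bool.xor_not, Bool.not_xor]

theorem weight_pos (hm : 2 ≤ m) (hn : 2 ≤ n) (b : Bool) (k : ℕ) : 0 < weight m n b k :=
  Finset.prod_pos fun _ _ => ratio_pos hm hn _

theorem ratio_le_one (hm : 2 ≤ m) (hn : 2 ≤ n) (b : Bool) : ratio m n b ≤ 1 := by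
  have hm' : (1 : ℝ) ≤ m := by exact_mod_cast one_le_two.trans hm
  have hn' : (1 : ℝ) ≤ n - 1 := le_sub_right_of_add_le (by norm_num; exact_mod_cast hn)
  cases b <;> simp only [ratio, Bool.false_eq_true, if_false, if_true]
  exacts [div_le_one_of_le₀ hn' (by linarith), div_le_one_of_le₀ hm' (by linarith)]

theorem ratio_mul_ratio_not_le (hm : 2 ≤ m) (hn : 2 ≤ n) (b : Bool) :
    ratio m n b * ratio m n (!b) ≤ 1 / 2 := by
  have htrue : ratio m n true ≤ 1 / 2 := by
    simp only [ratio, if_true]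
    gcongr
    exact_mod_cast hm
  have := mul_le_mul htrue (ratio_le_one hm hn false) (ratio_pos hm hn false).le (by norm_num)
  cases b
  · simp only [Bool.not_false]
    linarith
  · simp only [Bool.not_true]
    linarith

theorem weight_le (hm : 2 ≤ m) (hn : 2 ≤ n) (b : Bool) (k : ℕ) :
    weight m n b k ≤ 2 * (3 / 4) ^ k := by
  induction k using Nat.twoStepInduction with
  | zero => norm_num [weight]
  | one =>
    rw [weight, Finset.prod_range_one]
    linarith [ratio_le_one hm hn (xor b (Nat.bodd 0))]
  | more k ih _ =>
    have h := mul_le_mul_of_nonneg_right (ratio_mul_ratio_not_le hm hn b) (weight_pos hm hn b k).le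
    have : (0 : ℝ) < (3 / 4) ^ k := by positivity
    rw [weight_succ, weight_succ, Bool.not_not, ← mul_assoc, pow_add]
    linarith

variable {b : Bool} {l l' : ℕ → ℕ}

theorem weight_mul_digit_nonneg (hm : 2 ≤ m) (hn : 2 ≤ n) (hl : l ∈ admissible m n b) (k : ℕ) :
    0 ≤ weight m n b k * digit m n (xor b k.bodd) (l k) :=
  mul_nonneg (weight_pos hm hn b k).le (digit_nonneg hn _ (hl k).1)

theorem norm_weight_mul_digit_le (hm : 2 ≤ m) (hn : 2 ≤ n) (hl : l ∈ admissible m n b) (k : ℕ) :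
    ‖weight m n b k * digit m n (xor b k.bodd) (l k)‖ ≤ 2 * (3 / 4) ^ k := by
  have hdigit : digit m n (xor b k.bodd) (l k) ≤ 1 := by
    linarith [digit_add_ratio_le_one hm hn (xor b k.bodd) (hl k).2, ratio_pos hm hn (xor b k.bodd)]
  rw [Real.norm_of_nonneg (weight_mul_digit_nonneg hm hn hl k)]
  exact (mul_le_of_le_one_right (weight_pos hm hn b k).le hdigit).trans (weight_le hm hn b k)

theorem summable_two_mul_pow : Summable fun k : ℕ => 2 * (3 / 4 : ℝ) ^ k :=
  (summable_geometric_of_lt_one (by norm_num) (by norm_num)).mul_left 2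

theorem continuousOn_coord (hm : 2 ≤ m) (hn : 2 ≤ n) (b : Bool) :
    ContinuousOn (coord m n b) (admissible m n b) :=
  continuousOn_tsum
    (fun k => (continuous_const.mul
      ((continuous_of_discreteTopology (f := digit m n (xor b k.bodd))).comp
        (continuous_apply k))).continuousOn)
    summable_two_mul_pow fun k _ hl => norm_weight_mul_digit_le hm hn hl k

theorem coord_eq (hm : 2 ≤ m) (hn : 2 ≤ n) (hl : l ∈ admissible m n b) :
    coord m n b l = digit m n b (l 0) + ratio m n b * coord m n (!b) fun k => l (k + 1) := by
  have hsum := Summable.of_norm_bounded summable_two_mul_pow (norm_weight_mul_digit_le hm hn hl)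
  rw [coord, hsum.tsum_eq_zero_add, coord, ← tsum_mul_left]
  congr 1
  · simp [weight]
  · refine tsum_congr fun k => ?_
    rw [weight_succ, Nat.bodd_succ, Bool.xor_not, ← Bool.not_xor, mul_assoc]

theorem sum_range_add_weight_le_one (hm : 2 ≤ m) (hn : 2 ≤ n) (hl : l ∈ admissible m n b)
    (N : ℕ) : ∑ k ∈ Finset.range N, weight m n b k * digit m n (xor b k.bodd) (l k) +
      weight m n b N ≤ 1 := by
  induction N with
  | zero => simp [weight]
  | succ N ih =>
    have h := mul_le_mul_of_nonneg_left (digit_add_ratio_le_one hm hn _ (hl N).2)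
      (weight_pos hm hn b N).le
    have hw : weight m n b (N + 1) = weight m n b N * ratio m n (xor b N.bodd) :=
      Finset.prod_range_succ _ _
    rw [Finset.sum_range_succ, hw]
    linarith

theorem coord_mem_Icc (hm : 2 ≤ m) (hn : 2 ≤ n) (hl : l ∈ admissible m n b) :
    coord m n b l ∈ Set.Icc (0 : ℝ) 1 :=
  have h0 := weight_mul_digit_nonneg hm hn hl
  ⟨tsum_nonneg h0, Real.tsum_le_of_sum_range_le h0 fun N => by
    linarith [sum_range_add_weight_le_one hm hn hl N, weight_pos hm hn b N]⟩

theorem coord_true_mem_Ioo (hm : 2 ≤ m) (hn : 2 ≤ n) (hl : l ∈ admissible m n true) :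
    coord m n true l ∈ Set.Ioo (0 : ℝ) 1 := by
  have htail := coord_mem_Icc hm hn (tail_mem_admissible hl)
  have hr := ratio_pos hm hn true
  rw [coord_eq hm hn hl]
  exact ⟨add_pos_of_pos_of_nonneg (digit_true_pos hm (hl 0).1) (mul_nonneg hr.le htail.1),
    (add_le_add_right (mul_le_of_le_one_right hr.le htail.2) _).trans_lt
      (digit_true_add_ratio_lt_one hm (hl 0).2)⟩

theorem coord_mem_Ioo (hm : 2 ≤ m) (hn : 2 ≤ n) (hl : l ∈ admissible m n b) :
    coord m n b l ∈ Set.Ioo (0 : ℝ) 1 := by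
  cases b
  · have htail := coord_true_mem_Ioo hm hn (tail_mem_admissible hl)
    have hr := ratio_pos hm hn false
    rw [coord_eq hm hn hl]
    exact ⟨add_pos_of_nonneg_of_pos (digit_nonneg hn _ (hl 0).1) (mul_pos hr htail.1),
      (add_lt_add_right (mul_lt_of_lt_one_right hr htail.2) _).trans_le
        (digit_add_ratio_le_one hm hn _ (hl 0).2)⟩
  · exact coord_true_mem_Ioo hm hn hl

theorem coord_lt_coord (hm : 2 ≤ m) (hn : 2 ≤ n) (hl : l ∈ admissible m n b)
    (hl' : l' ∈ admissible m n b) (h : l 0 < l' 0) : coord m n b l < coord m n b l' := by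
  have hr := ratio_pos hm hn b
  have hu := coord_mem_Ioo hm hn (tail_mem_admissible hl)
  have hu' := coord_mem_Ioo hm hn (tail_mem_admissible hl')
  rw [coord_eq hm hn hl, coord_eq hm hn hl']
  calc _ < digit m n b (l 0) + ratio m n b := add_lt_add_right (mul_lt_of_lt_one_right hr hu.2) _
    _ ≤ digit m n b (l' 0) := digit_add_ratio_le_digit hn b h
    _ ≤ _ := le_add_of_nonneg_right (mul_pos hr hu'.1).le

theorem head_eq_of_coord_eq (hm : 2 ≤ m) (hn : 2 ≤ n) (hl : l ∈ admissible m n b)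
    (hl' : l' ∈ admissible m n b) (h : coord m n b l = coord m n b l') : l 0 = l' 0 :=
  le_antisymm (not_lt.1 fun hlt => (coord_lt_coord hm hn hl' hl hlt).ne' h)
    (not_lt.1 fun hlt => (coord_lt_coord hm hn hl hl' hlt).ne h)

theorem coord_injOn (hm : 2 ≤ m) (hn : 2 ≤ n) (b : Bool) :
    Set.InjOn (coord m n b) (admissible m n b) := by
  intro l hl l' hl' h
  funext k
  induction k generalizing b l l' with
  | zero => exact head_eq_of_coord_eq hm hn hl hl' h
  | succ _ ih =>
    have htail := h
    rw [coord_eq hm hn hl, coord_eq hm hn hl', head_eq_of_coord_eq hm hn hl hl' h, add_right_inj,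
      mul_right_inj' (ratio_pos hm hn b).ne'] at htail
    exact ih _ (tail_mem_admissible hl) (tail_mem_admissible hl') htail

end Coord

section Value

/-- The lift to `(0, 1)` of the point of the circle coded by a sign and a sequence of labels. The
codes with sign `+` fill a part of `(0, m / (m + 1))`, those with sign `-` a part of
`(m / (m + 1), 1)`. -/
noncomputable def value (m n : ℕ) (b : Bool) (l : ℕ → ℕ) : ℝ :=
  if b then m / (m + 1) * coord m n true l else m / (m + 1) + 1 / (m + 1) * coord m n false l

variable {m n : ℕ} {b : Bool} {l l' : ℕ → ℕ}

theorem value_true_mem_Ioo (hm : 2 ≤ m) (hn : 2 ≤ n) (hl : l ∈ admissible m n true) :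
    value m n true l ∈ Set.Ioo (0 : ℝ) (m / (m + 1)) := by
  have h := coord_mem_Ioo hm hn hl
  have hc : (0 : ℝ) < m / (m + 1) := by positivity
  simp only [value, if_true]
  exact ⟨mul_pos hc h.1, mul_lt_of_lt_one_right hc h.2⟩

theorem value_false_mem_Ioo (hm : 2 ≤ m) (hn : 2 ≤ n) (hl : l ∈ admissible m n false) :
    value m n false l ∈ Set.Ioo (m / (m + 1) : ℝ) 1 := by
  have h := coord_mem_Ioo hm hn hl
  have hc : (0 : ℝ) < 1 / (m + 1) := by positivity
  have hsum : (m / (m + 1) + 1 / (m + 1) : ℝ) = 1 := by field_simp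
  simp only [value, Bool.false_eq_true, if_false]
  exact ⟨lt_add_of_pos_right _ (mul_pos hc h.1),
    (add_lt_add_right (mul_lt_of_lt_one_right hc h.2) _).trans_eq hsum⟩

theorem value_mem_Ioo (hm : 2 ≤ m) (hn : 2 ≤ n) (hl : l ∈ admissible m n b) :
    value m n b l ∈ Set.Ioo (0 : ℝ) 1 := by
  have hc := div_add_one_mem_Ioo (two_pos.trans_le hm)
  cases b
  · exact Set.Ioo_subset_Ioo_left hc.1.le (value_false_mem_Ioo hm hn hl)
  · exact Set.Ioo_subset_Ioo_right hc.2.le (value_true_mem_Ioo hm hn hl)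

theorem value_true_lt_value_false (hm : 2 ≤ m) (hn : 2 ≤ n) (hl : l ∈ admissible m n true)
    (hl' : l' ∈ admissible m n false) : value m n true l < value m n false l' :=
  (value_true_mem_Ioo hm hn hl).2.trans (value_false_mem_Ioo hm hn hl').1

theorem value_lt_value_iff (hm : 2 ≤ m) (b : Bool) :
    value m n b l < value m n b l' ↔ coord m n b l < coord m n b l' := by
  have hc : (0 : ℝ) < m / (m + 1) := by positivity
  have hc' : (0 : ℝ) < 1 / (m + 1) := by positivity
  cases b <;> simp only [value, Bool.false_eq_true, if_false, if_true]
  · rw [add_lt_add_iff_left, mul_lt_mul_iff_right₀ hc']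
  · rw [mul_lt_mul_iff_right₀ hc]

theorem value_lt_value (hm : 2 ≤ m) (hn : 2 ≤ n) (hl : l ∈ admissible m n b)
    (hl' : l' ∈ admissible m n b) (h : l 0 < l' 0) : value m n b l < value m n b l' :=
  (value_lt_value_iff hm b).2 (coord_lt_coord hm hn hl hl' h)

theorem value_injective (hm : 2 ≤ m) (hn : 2 ≤ n) {b b' : Bool} (hl : l ∈ admissible m n b)
    (hl' : l' ∈ admissible m n b') (h : value m n b l = value m n b' l') : b = b' ∧ l = l' := by
  have hb : b = b' := by
    cases b <;> cases b'
    · rfl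
    · exact absurd h (value_true_lt_value_false hm hn hl' hl).ne'
    · exact absurd h (value_true_lt_value_false hm hn hl hl').ne
    · rfl
  subst hb
  have hcoord : coord m n b l = coord m n b l' :=
    le_antisymm (not_lt.1 fun hlt => ((value_lt_value_iff hm b).2 hlt).ne' h)
      (not_lt.1 fun hlt => ((value_lt_value_iff hm b).2 hlt).ne h)
  exact ⟨rfl, coord_injOn hm hn b hl hl' hcoord⟩

theorem continuousOn_value (hm : 2 ≤ m) (hn : 2 ≤ n) (b : Bool) :
    ContinuousOn (value m n b) (admissible m n b) := by
  cases b
  · exact continuousOn_const.add (continuousOn_const.mul (continuousOn_coord hm hn false))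
  · exact continuousOn_const.mul (continuousOn_coord hm hn true)

theorem generator_pow_value (hm : 2 ≤ m) (hn : 2 ≤ n) (hl : l ∈ admissible m n b) :
    circleHom (generator hm hn b ^ l 0) ((value m n (!b) fun k => l (k + 1) : ℝ)) =
      ((value m n b l : ℝ) : AddCircle (1 : ℝ)) := by
  rw [circleHom_coe]
  cases b
  · have htail : coord m n true (fun k => l (k + 1)) ∈ Set.Ioo (0 : ℝ) 1 :=
      coord_mem_Ioo hm hn (tail_mem_admissible hl)
    simp only [value, Bool.not_false, if_true, Bool.false_eq_true, if_false]
    rw [generator_false_pow_apply hm hn (hl 0).1 (hl 0).2 htail, coord_eq hm hn hl]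
    simp only [digit, ratio, Bool.false_eq_true, if_false, Bool.not_false]
    rw [add_div _ _ (n - 1 : ℝ), one_div_mul_eq_div (n - 1 : ℝ)]
  · have hm' : (m : ℝ) ≠ 0 := by positivity
    simp only [value, Bool.not_true, if_true, Bool.false_eq_true, if_false]
    rw [generator_true_pow_apply, coord_eq hm hn hl, ← AddCircle.coe_add_period (1 : ℝ) (_ * _)]
    simp only [digit, ratio, if_true, Bool.not_true]
    congr 1
    field_simp
    ring

end Value

/-! ### Codes of ends -/

section Tree

variable {m n : ℕ} {b b' : Bool} {g g' : Zmn m n}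

theorem two_le_valence (hm : 2 ≤ m) (hn : 2 ≤ n) (b : Bool) : 2 ≤ valence m n b := by
  cases b
  exacts [hn, hm]

theorem vert_type_eq (h : vert b g = vert b' g') : b = b' := by
  cases b <;> cases b' <;> simp [vert] at h ⊢

theorem vert_eq_iff : vert b g = vert b g' ↔ g⁻¹ * g' ∈ Subgroup.zpowers (letter m n b) := by
  cases b <;> simp [vert, letter, QuotientGroup.eq]

theorem disjoint_zpowers_X_Y (m n : ℕ) :
    Disjoint (Subgroup.zpowers (X m n)) (Subgroup.zpowers (Y m n)) := by
  rw [Subgroup.disjoint_def]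
  rintro _ ⟨i, rfl⟩ ⟨j, hj⟩
  have hfst := congrArg Monoid.Coprod.fst hj
  simp only [X, Y, map_zpow, Monoid.Coprod.fst_apply_inl, Monoid.Coprod.fst_apply_inr,
    one_zpow] at hfst
  simp only [X]
  rw [← map_zpow, ← hfst, map_one]

theorem edge_eq_of_vert_eq (h : vert b g = vert b g') (h' : vert (!b) g = vert (!b) g') :
    g = g' := by
  rw [vert_eq_iff] at h h'
  rw [← inv_mul_eq_one]
  cases b
  · exact Subgroup.disjoint_def.1 (disjoint_zpowers_X_Y m n) h' h
  · exact Subgroup.disjoint_def.1 (disjoint_zpowers_X_Y m n) h h'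

theorem orderOf_letter (m n : ℕ) (b : Bool) : orderOf (letter m n b) = valence m n b := by
  cases b
  · exact (orderOf_injective _ Monoid.Coprod.inr_injective _).trans
      ((orderOf_ofAdd_eq_addOrderOf _).trans (ZMod.addOrderOf_one n))
  · exact (orderOf_injective _ Monoid.Coprod.inl_injective _).trans
      ((orderOf_ofAdd_eq_addOrderOf _).trans (ZMod.addOrderOf_one m))

theorem letter_pow_valence (m n : ℕ) (b : Bool) : letter m n b ^ valence m n b = 1 := by
  rw [← orderOf_letter, pow_orderOf_eq_one]

theorem exists_eq_mul_letter_pow (hv : 0 < valence m n b) (h : vert b g = vert b g')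
    (h' : vert (!b) g ≠ vert (!b) g') :
    ∃ l, 0 < l ∧ l < valence m n b ∧ g' = g * letter m n b ^ l := by
  classical
  have hfin : IsOfFinOrder (letter m n b) := by rwa [← orderOf_pos_iff, orderOf_letter]
  rw [vert_eq_iff, hfin.mem_zpowers_iff_mem_range_orderOf, Finset.mem_image] at h
  obtain ⟨l, hl, hpow⟩ := h
  obtain rfl := (inv_mul_eq_iff_eq_mul.1 hpow.symm)
  rw [Finset.mem_range, orderOf_letter] at hl
  refine ⟨l, Nat.pos_of_ne_zero ?_, hl, rfl⟩
  rintro rfl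
  simp at h'

theorem closure_range_letter (hm : m ≠ 0) (hn : n ≠ 0) :
    Submonoid.closure (Set.range (letter m n)) = ⊤ := by
  have hofAdd : ∀ (k : ℕ) [NeZero k] (z : Multiplicative (ZMod k)),
      Multiplicative.ofAdd 1 ^ z.toAdd.val = z := fun k _ z => by
    rw [← ofAdd_nsmul, nsmul_one, ZMod.natCast_zmod_val, ofAdd_toAdd]
  have : NeZero m := ⟨hm⟩
  have : NeZero n := ⟨hn⟩
  rw [eq_top_iff, ← Monoid.Coprod.mrange_inl_sup_mrange_inr, sup_le_iff]
  constructor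
  · rintro _ ⟨z, rfl⟩
    rw [← hofAdd m z, map_pow]
    exact pow_mem (Submonoid.subset_closure (Set.mem_range_self true)) _
  · rintro _ ⟨z, rfl⟩
    rw [← hofAdd n z, map_pow]
    exact pow_mem (Submonoid.subset_closure (Set.mem_range_self false)) _

theorem Ends.smul_mul (g h : Zmn m n) (e : Ends m n) :
    Ends.smul (g * h) e = Ends.smul g (Ends.smul h e) := by
  induction e using Quotient.inductionOn with
  | h r => exact Quotient.sound ⟨0, 0, fun k => mul_smul _ _ _⟩

theorem Ends.smul_one (e : Ends m n) : Ends.smul 1 e = e := by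
  induction e using Quotient.inductionOn with
  | h r => exact Quotient.sound ⟨0, 0, fun k => one_smul _ _⟩

end Tree

namespace Code

variable {m n : ℕ}

theorem label_mem_admissible (c : Code m n) : c.label ∈ admissible m n c.sign :=
  fun k => ⟨c.pos k, c.lt k⟩

/-- The code with a given admissible sequence of labels. -/
def ofAdmissible {b : Bool} {l : ℕ → ℕ} (hl : l ∈ admissible m n b) : Code m n where
  sign := b
  label := l
  pos k := (hl k).1
  lt k := (hl k).2

theorem eq_of_sign_eq_of_label_eq {c d : Code m n} (hs : c.sign = d.sign)
    (hl : c.label = d.label) : c = d := by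
  obtain ⟨s, l, _, _⟩ := c
  obtain ⟨s', l', _, _⟩ := d
  subst hs hl
  rfl

/-- The code without its first label. -/
def tail (c : Code m n) : Code m n := ofAdmissible (tail_mem_admissible c.label_mem_admissible)

/-- The code with an additional first label. -/
def cons (c : Code m n) (l : ℕ) (hl : 0 < l) (hl' : l < valence m n (!c.sign)) : Code m n where
  sign := !c.sign
  label k := Nat.casesOn k l c.label
  pos k := by
    cases k
    exacts [hl, c.pos _]
  lt k := by
    cases k with
    | zero => simpa using hl'
    | succ k => simpa [Nat.bodd_succ] using c.lt k

theorem tail_cons (c : Code m n) (l : ℕ) (hl : 0 < l) (hl' : l < valence m n (!c.sign)) :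
    (c.cons l hl hl').tail = c :=
  eq_of_sign_eq_of_label_eq (Bool.not_not _) rfl

theorem side_tail (c : Code m n) (k : ℕ) : c.tail.side k = c.side (k + 1) := by
  rw [side_succ]
  exact Bool.not_xor _ _

theorem edge_tail (c : Code m n) (k : ℕ) :
    letter m n c.sign ^ c.label 0 * c.tail.edge k = c.edge (k + 1) := by
  induction k with
  | zero => simp [edge, side]
  | succ k ih =>
    rw [edge, ← mul_assoc, ih, edge, side_tail]
    rfl

theorem ray_succ (c : Code m n) (k : ℕ) :
    c.ray.toFun (k + 1) = letter m n c.sign ^ c.label 0 • c.tail.ray.toFun k := by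
  change vert _ _ = _ • vert _ _
  rw [smul_vert, edge_tail, side_tail]

theorem toEnd_eq_smul_tail (c : Code m n) :
    c.toEnd = Ends.smul (letter m n c.sign ^ c.label 0) c.tail.toEnd :=
  Quotient.sound ⟨1, 0, fun k => by
    rw [zero_add, add_comm]
    exact c.ray_succ k⟩

theorem toEnd_cons (c : Code m n) (l : ℕ) (hl : 0 < l) (hl' : l < valence m n (!c.sign)) :
    (c.cons l hl hl').toEnd = Ends.smul (letter m n (!c.sign) ^ l) c.toEnd := by
  rw [toEnd_eq_smul_tail, tail_cons]
  rfl

theorem smul_ray_apply (g : Zmn m n) (c : Code m n) (k : ℕ) :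
    g • c.ray.toFun k = vert (!c.side k) (g * c.edge k) :=
  smul_vert _ _ _

theorem smul_ray_succ (g : Zmn m n) (c : Code m n) (k : ℕ) :
    g • c.ray.toFun (k + 1) = vert (c.side k) (g * c.edge k) := by
  rw [smul_ray_apply, side_succ, edge, ← mul_assoc, Bool.not_not, vert_mul_pow]

theorem side_eq_of_smul_ray_eq {g g' : Zmn m n} {c c' : Code m n} {k : ℕ}
    (h : g • c.ray.toFun k = g' • c'.ray.toFun k) : c.side k = c'.side k := by
  rw [smul_ray_apply, smul_ray_apply] at h
  exact Bool.not_inj (vert_type_eq h)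

theorem eq_of_smul_ray_eq {g g' : Zmn m n} {c c' : Code m n}
    (h : ∀ k, g • c.ray.toFun k = g' • c'.ray.toFun k) : g = g' ∧ c = c' := by
  have hside : ∀ k, c.side k = c'.side k := fun k => side_eq_of_smul_ray_eq (h k)
  have hedge : ∀ k, g * c.edge k = g' * c'.edge k := by
    intro k
    have h1 := h k
    have h2 := h (k + 1)
    rw [smul_ray_apply, smul_ray_apply, hside] at h1
    rw [smul_ray_succ, smul_ray_succ, hside] at h2
    exact edge_eq_of_vert_eq h2 h1
  obtain rfl : g = g' := by simpa only [edge, mul_one] using hedge 0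
  refine ⟨rfl, eq_of_sign_eq_of_label_eq ?_ (funext fun k => ?_)⟩
  · simpa only [side, Nat.bodd_zero, Bool.xor_false] using hside 0
  · have hpow := mul_left_cancel (hedge (k + 1))
    rw [edge, edge, mul_left_cancel (hedge k), hside, mul_right_inj] at hpow
    have hlt : c.label k < valence m n (c.side k) := c.lt k
    have hlt' : c'.label k < valence m n (c'.side k) := c'.lt k
    rw [hside, ← orderOf_letter] at hlt
    rw [← orderOf_letter] at hlt'
    exact pow_injOn_Iio_orderOf hlt hlt' hpow

theorem exists_smul_ray_eq (hm : 2 ≤ m) (hn : 2 ≤ n) (r : Ray m n) :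
    ∃ (g : Zmn m n) (c : Code m n), ∀ k, r.toFun k = g • c.ray.toFun k := by
  choose e t hr hr' using r.adj
  have ht : ∀ k, t (k + 1) = !t k := fun k => vert_type_eq ((hr (k + 1)).symm.trans (hr' k))
  have hturn : ∀ k, ∃ l, 0 < l ∧ l < valence m n (!t k) ∧
      e (k + 1) = e k * letter m n (!t k) ^ l := by
    intro k
    refine exists_eq_mul_letter_pow (two_pos.trans_le (two_le_valence hm hn _)) ?_ ?_
    · rw [← hr' k, hr (k + 1), ht]
    · have hred := r.reduced k
      rw [hr k, hr' (k + 1), ht, Bool.not_not] at hred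
      rwa [Bool.not_not, ne_comm]
  choose l hpos hlt he using hturn
  have ht_zero : ∀ k, (xor (!t 0) k.bodd) = !t k := by
    intro k
    induction k with
    | zero => simp
    | succ k ih => rw [Nat.bodd_succ, Bool.xor_not, ih, ht]
  let c : Code m n := ⟨!t 0, l, hpos, fun k => by rw [ht_zero]; exact hlt k⟩
  have hside : ∀ k, c.side k = !t k := ht_zero
  have hedge : ∀ k, e 0 * c.edge k = e k := by
    intro k
    induction k with
    | zero => exact mul_one _
    | succ k ih => rw [edge, ← mul_assoc, ih, he, hside]
  exact ⟨e 0, c, fun k => by rw [hr k, smul_ray_apply, hedge, hside, Bool.not_not]⟩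

theorem exists_smul_toEnd_eq_of_edge (hm : 2 ≤ m) (hn : 2 ≤ n) {r : Ray m n} {b : Bool}
    {g : Zmn m n} (h0 : r.toFun 0 = vert b g) (h1 : r.toFun 1 = vert (!b) g) :
    ∃ c : Code m n, c.sign = !b ∧ r.toEnd = Ends.smul g c.toEnd := by
  obtain ⟨g', c, hc⟩ := exists_smul_ray_eq hm hn r
  rw [hc, smul_ray_apply] at h0
  rw [hc, smul_ray_succ] at h1
  have hside : c.side 0 = !b := vert_type_eq h1
  have hsign : c.sign = !b := by simpa only [side, Nat.bodd_zero, Bool.xor_false] using hside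
  rw [hside, Bool.not_not, edge, mul_one] at h0
  rw [hside, edge, mul_one] at h1
  obtain rfl := edge_eq_of_vert_eq h0 h1
  exact ⟨c, hsign, Quotient.sound ⟨0, 0, fun k => hc _⟩⟩

theorem exists_letter_smul_toEnd_eq (hm : 2 ≤ m) (hn : 2 ≤ n) (b : Bool) (c : Code m n) :
    ∃ d : Code m n, Ends.smul (letter m n b) c.toEnd = d.toEnd := by
  by_cases hb : c.sign = b
  · subst hb
    have hs : (!c.tail.sign) = c.sign := Bool.not_not _
    have hlt : c.label 0 < valence m n c.sign := by
      simpa only [Nat.bodd_zero, Bool.xor_false] using c.lt 0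
    rw [toEnd_eq_smul_tail, ← Ends.smul_mul, ← pow_succ']
    rcases (Nat.succ_le_of_lt hlt).eq_or_lt with heq | hlt
    · refine ⟨c.tail, ?_⟩
      rw [← Nat.succ_eq_add_one, heq, letter_pow_valence, Ends.smul_one]
    · refine ⟨c.tail.cons (c.label 0 + 1) (Nat.succ_pos _) (by rwa [hs]), ?_⟩
      rw [toEnd_cons, hs]
  · obtain rfl : (!c.sign) = b := (Bool.eq_not.2 (Ne.symm hb)).symm
    refine ⟨c.cons 1 one_pos (two_le_valence hm hn _), ?_⟩
    rw [toEnd_cons, pow_one]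

theorem exists_smul_toEnd_eq (hm : 2 ≤ m) (hn : 2 ≤ n) (g : Zmn m n) (c : Code m n) :
    ∃ d : Code m n, Ends.smul g c.toEnd = d.toEnd := by
  have hg : g ∈ Submonoid.closure (Set.range (letter m n)) := by
    rw [closure_range_letter (by omega) (by omega)]
    trivial
  induction hg using Submonoid.closure_induction generalizing c with
  | mem g hg =>
    obtain ⟨b, rfl⟩ := hg
    exact exists_letter_smul_toEnd_eq hm hn b c
  | one => exact ⟨c, Ends.smul_one _⟩
  | mul g h _ _ hg hh =>
    obtain ⟨d, hd⟩ := hh c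
    rw [Ends.smul_mul, hd]
    exact hg d

theorem toEnd_surjective (hm : 2 ≤ m) (hn : 2 ≤ n) :
    Function.Surjective (toEnd : Code m n → Ends m n) := by
  intro e
  induction e using Quotient.inductionOn with
  | h r =>
    obtain ⟨g, c, hc⟩ := exists_smul_ray_eq hm hn r
    obtain ⟨d, hd⟩ := exists_smul_toEnd_eq hm hn g c
    exact ⟨d, hd.symm.trans (Quotient.sound ⟨0, 0, fun k => (hc _).symm⟩)⟩

/-- The point of the circle with a given code. -/
noncomputable def circlePoint (c : Code m n) : AddCircle (1 : ℝ) := (value m n c.sign c.label : ℝ)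

theorem circlePoint_injective (hm : 2 ≤ m) (hn : 2 ≤ n) :
    Function.Injective (circlePoint : Code m n → AddCircle (1 : ℝ)) := by
  intro c d h
  have hmem : ∀ c : Code m n, value m n c.sign c.label ∈ Set.Ico (0 : ℝ) (0 + 1) := fun c => by
    rw [zero_add]
    exact Set.Ioo_subset_Ico_self (value_mem_Ioo hm hn c.label_mem_admissible)
  obtain ⟨hsign, hlabel⟩ := value_injective hm hn c.label_mem_admissible d.label_mem_admissible
    ((AddCircle.coe_eq_coe_iff_of_mem_Ico (hmem c) (hmem d)).1 h)
  exact eq_of_sign_eq_of_label_eq hsign hlabel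

theorem range_circlePoint (m n : ℕ) : Set.range (circlePoint : Code m n → AddCircle (1 : ℝ)) =
    ⋃ b, (fun l => ((value m n b l : ℝ) : AddCircle (1 : ℝ))) '' admissible m n b := by
  ext z
  simp only [Set.mem_range, Set.mem_iUnion, Set.mem_image]
  constructor
  · rintro ⟨c, rfl⟩
    exact ⟨c.sign, c.label, c.label_mem_admissible, rfl⟩
  · rintro ⟨b, l, hl, rfl⟩
    exact ⟨ofAdmissible hl, rfl⟩

theorem isClosed_range_circlePoint (hm : 2 ≤ m) (hn : 2 ≤ n) :
    IsClosed (Set.range (circlePoint : Code m n → AddCircle (1 : ℝ))) := by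
  rw [range_circlePoint]
  exact isClosed_iUnion_of_finite fun b => ((isCompact_admissible m n b).image_of_continuousOn
    ((AddCircle.continuous_mk' (1 : ℝ)).comp_continuousOn (continuousOn_value hm hn b))).isClosed

end Code

section Existence

/-- The homomorphism from `ℤ_k` sending the generator to a given element. -/
noncomputable def zmodHom {H : Type*} [Group H] {k : ℕ} {h : H} (hk : h ^ k = 1) :
    Multiplicative (ZMod k) →* H :=
  monoidHomOfForallMemZpowers (g := Multiplicative.ofAdd (1 : ZMod k)) (g' := h)
    (fun z => ⟨z.toAdd.cast, by
      change Multiplicative.ofAdd (1 : ZMod k) ^ (z.toAdd.cast : ℤ) = z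
      rw [← ofAdd_zsmul, zsmul_one, ZMod.intCast_zmod_cast, ofAdd_toAdd]⟩)
    (by rw [orderOf_ofAdd_eq_addOrderOf, ZMod.addOrderOf_one, orderOf_dvd_iff_pow_eq_one, hk])

theorem zmodHom_ofAdd_one {H : Type*} [Group H] {k : ℕ} {h : H} (hk : h ^ k = 1) :
    zmodHom hk (Multiplicative.ofAdd 1) = h :=
  monoidHomOfForallMemZpowers_apply_gen _ _

theorem circleHom_translate_one : circleHom (CircleDeg1Lift.translate (.ofAdd 1)) = 1 := by
  ext z
  induction z using QuotientAddGroup.induction_on with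
  | H t =>
    rw [circleHom_coe, CircleDeg1Lift.translate_apply, add_comm]
    exact AddCircle.coe_add_period 1 t

variable {m n : ℕ} (hm : 2 ≤ m) (hn : 2 ≤ n)

theorem circleHom_generator_pow_valence (b : Bool) :
    circleHom (generator hm hn b) ^ valence m n b = 1 := by
  rw [← map_pow, generator_pow_valence, circleHom_translate_one]

/-- The action of `Z_{m,n}` on the circle by the images of the generators of the action on the
line. -/
noncomputable def circleAction : Zmn m n →* (AddCircle (1 : ℝ) ≃ₜ AddCircle (1 : ℝ)) :=
  Monoid.Coprod.lift (zmodHom (circleHom_generator_pow_valence hm hn true))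
    (zmodHom (circleHom_generator_pow_valence hm hn false))

theorem circleAction_letter (b : Bool) :
    circleAction hm hn (letter m n b) = circleHom (generator hm hn b) := by
  cases b
  · exact (Monoid.Coprod.lift_apply_inr _ _ _).trans (zmodHom_ofAdd_one _)
  · exact (Monoid.Coprod.lift_apply_inl _ _ _).trans (zmodHom_ofAdd_one _)

theorem circleAction_mul_apply (g h : Zmn m n) (z : AddCircle (1 : ℝ)) :
    circleAction hm hn (g * h) z = circleAction hm hn g (circleAction hm hn h z) := by
  rw [map_mul]
  rfl

theorem circleAction_one_apply (z : AddCircle (1 : ℝ)) : circleAction hm hn 1 z = z := by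
  rw [map_one]
  rfl

theorem sbtw_circleAction (g : Zmn m n) {u v w : AddCircle (1 : ℝ)} (h : sbtw u v w) :
    sbtw (circleAction hm hn g u) (circleAction hm hn g v) (circleAction hm hn g w) := by
  have hg : g ∈ Submonoid.closure (Set.range (letter m n)) := by
    rw [closure_range_letter (by omega) (by omega)]
    trivial
  induction hg using Submonoid.closure_induction generalizing u v w with
  | mem g hg =>
    obtain ⟨b, rfl⟩ := hg
    rw [circleAction_letter]
    exact sbtw_circleHom _ h
  | one => simpa only [circleAction_one_apply] using h
  | mul g g' _ _ hg hg' =>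
    simp only [circleAction_mul_apply]
    exact hg (hg' h)

theorem circleAction_circlePoint_tail (c : Code m n) :
    circleAction hm hn (letter m n c.sign ^ c.label 0) c.tail.circlePoint = c.circlePoint := by
  rw [map_pow, circleAction_letter, ← map_pow]
  exact generator_pow_value hm hn c.label_mem_admissible

theorem circlePoint_cons (c : Code m n) {l : ℕ} (hl : 0 < l) (hl' : l < valence m n (!c.sign)) :
    (c.cons l hl hl').circlePoint =
      circleAction hm hn (letter m n (!c.sign) ^ l) c.circlePoint := by
  rw [← circleAction_circlePoint_tail hm hn, Code.tail_cons]
  rfl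

theorem exists_smul_ray_eq_smul_ray_add (a : ℕ) (g : Zmn m n) (c : Code m n) :
    ∃ (h : Zmn m n) (d : Code m n), (∀ k, h • d.ray.toFun k = g • c.ray.toFun (a + k)) ∧
      circleAction hm hn h d.circlePoint = circleAction hm hn g c.circlePoint := by
  induction a generalizing g c with
  | zero => exact ⟨g, c, fun k => by rw [zero_add], rfl⟩
  | succ a ih =>
    obtain ⟨h, d, hray, hpoint⟩ := ih (g * letter m n c.sign ^ c.label 0) c.tail
    refine ⟨h, d, fun k => ?_, ?_⟩
    · rw [hray, mul_smul, ← Code.ray_succ, add_right_comm]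
    · rw [hpoint, circleAction_mul_apply, circleAction_circlePoint_tail]

theorem circleAction_circlePoint_eq_of_smul_toEnd_eq {g g' : Zmn m n} {c c' : Code m n}
    (h : Ends.smul g c.toEnd = Ends.smul g' c'.toEnd) :
    circleAction hm hn g c.circlePoint = circleAction hm hn g' c'.circlePoint := by
  obtain ⟨a, a', hrays⟩ := Quotient.exact h
  obtain ⟨f, d, hray, hpoint⟩ := exists_smul_ray_eq_smul_ray_add hm hn a g c
  obtain ⟨f', d', hray', hpoint'⟩ := exists_smul_ray_eq_smul_ray_add hm hn a' g' c'
  obtain ⟨rfl, rfl⟩ := Code.eq_of_smul_ray_eq fun k =>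
    ((hray k).trans (hrays k)).trans (hray' k).symm
  rw [← hpoint, ← hpoint']

/-- The embedding of the ends of the tree into the circle. -/
noncomputable def endPoint (e : Ends m n) : AddCircle (1 : ℝ) :=
  (Function.surjInv (Code.toEnd_surjective hm hn) e).circlePoint

theorem endPoint_smul_toEnd (g : Zmn m n) (c : Code m n) :
    endPoint hm hn (Ends.smul g c.toEnd) = circleAction hm hn g c.circlePoint := by
  rw [endPoint, ← circleAction_one_apply hm hn (Code.circlePoint _)]
  refine circleAction_circlePoint_eq_of_smul_toEnd_eq hm hn ?_
  rw [Ends.smul_one]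
  exact Function.surjInv_eq (Code.toEnd_surjective hm hn) _

theorem endPoint_toEnd (c : Code m n) : endPoint hm hn c.toEnd = c.circlePoint := by
  rw [← Ends.smul_one c.toEnd, endPoint_smul_toEnd, circleAction_one_apply]

theorem endPoint_injective : Function.Injective (endPoint hm hn) :=
  (Code.circlePoint_injective hm hn).comp (Function.injective_surjInv _)

theorem range_endPoint :
    Set.range (endPoint hm hn) = Set.range (Code.circlePoint : Code m n → AddCircle (1 : ℝ)) := by
  rw [← (Code.toEnd_surjective hm hn).range_comp]
  exact congrArg Set.range (funext (endPoint_toEnd hm hn))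

theorem circleAction_endPoint (g : Zmn m n) (e : Ends m n) :
    circleAction hm hn g (endPoint hm hn e) = endPoint hm hn (Ends.smul g e) := by
  obtain ⟨c, rfl⟩ := Code.toEnd_surjective hm hn e
  rw [endPoint_toEnd, endPoint_smul_toEnd]

include hm hn in
theorem Code.sbtw_circlePoint {c₁ c₂ c₃ : Code m n} (h12 : c₁.sign = !c₂.sign)
    (h23 : c₂.sign = c₃.sign) (h : c₂.label 0 < c₃.label 0) :
    sbtw c₁.circlePoint c₂.circlePoint c₃.circlePoint := by
  obtain ⟨b, hb⟩ : ∃ b, c₃.sign = b := ⟨_, rfl⟩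
  have hadm₁ := c₁.label_mem_admissible
  have hadm₂ := c₂.label_mem_admissible
  have hadm₃ := c₃.label_mem_admissible
  unfold circlePoint
  rw [h12, h23, hb] at hadm₁ ⊢
  rw [h23, hb] at hadm₂
  rw [hb] at hadm₃
  have hlt := value_lt_value hm hn hadm₂ hadm₃ h
  have hmem₁ := value_mem_Ioo hm hn hadm₁
  have hmem₂ := value_mem_Ioo hm hn hadm₂
  have hmem₃ := value_mem_Ioo hm hn hadm₃
  cases b
  · refine sbtw_coe_of_lt (value_true_lt_value_false hm hn hadm₁ hadm₂) hlt ?_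
    linarith [hmem₁.1, hmem₃.2]
  · have hlt' := value_true_lt_value_false hm hn hadm₃ hadm₁
    rw [← sub_add_cancel (value m n _ c₁.label) 1, AddCircle.coe_add_period]
    refine sbtw_coe_of_lt ?_ hlt (by rwa [sub_add_cancel])
    linarith [hmem₁.2, hmem₂.1]

section Edge

variable {r : Ray m n} {b : Bool} {g : Zmn m n} (h0 : r.toFun 0 = vert b g)

include h0

theorem endPoint_toEnd_of_edge (h1 : r.toFun 1 = vert (!b) g) :
    ∃ c : Code m n, c.sign = !b ∧
      endPoint hm hn r.toEnd = circleAction hm hn g c.circlePoint := by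
  obtain ⟨c, hsign, hc⟩ := Code.exists_smul_toEnd_eq_of_edge hm hn h0 h1
  exact ⟨c, hsign, by rw [hc, endPoint_smul_toEnd]⟩

theorem endPoint_toEnd_of_turn {l : ℕ} (hl : 0 < l) (hl' : l < valence m n b)
    (h1 : r.toFun 1 = vert (!b) (g * letter m n b ^ l)) :
    ∃ c : Code m n, c.sign = b ∧ c.label 0 = l ∧
      endPoint hm hn r.toEnd = circleAction hm hn g c.circlePoint := by
  rw [← Code.vert_mul_pow b g l] at h0
  obtain ⟨c, hsign, hc⟩ := endPoint_toEnd_of_edge hm hn h0 h1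
  obtain rfl : (!c.sign) = b := by rw [hsign, Bool.not_not]
  refine ⟨c.cons l hl hl', rfl, rfl, ?_⟩
  rw [hc, circleAction_mul_apply, circlePoint_cons hm hn]

end Edge

theorem sbtw_endPoint {e₁ e₂ e₃ : Ends m n} (h : Ends.Cyc e₁ e₂ e₃) :
    sbtw (endPoint hm hn e₁) (endPoint hm hn e₂) (endPoint hm hn e₃) := by
  obtain ⟨b, g, j, k, r₁, r₂, r₃, hj, hjk, hk, rfl, rfl, rfl, h1, h1', h2, h2', h3, h3'⟩ := h
  obtain ⟨c₁, hsign₁, hc₁⟩ := endPoint_toEnd_of_edge hm hn h1 h1'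
  obtain ⟨c₂, hsign₂, rfl, hc₂⟩ := endPoint_toEnd_of_turn hm hn h2 hj (hjk.trans hk) h2'
  obtain ⟨c₃, hsign₃, rfl, hc₃⟩ := endPoint_toEnd_of_turn hm hn h3 (hj.trans hjk) hk h3'
  rw [hc₁, hc₂, hc₃]
  exact sbtw_circleAction hm hn g
    (Code.sbtw_circlePoint hm hn (by rw [hsign₁, hsign₂]) (hsign₂.trans hsign₃.symm) hjk)

/-- The action of `G_{m,n}` on the line. -/
noncomputable def lineAction : Gmn m n →* CircleDeg1Liftˣ :=
  PresentedGroup.toGroup (f := ![generator hm hn true, generator hm hn false]) (by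
    rintro _ rfl
    have hpow : generator hm hn true ^ m = generator hm hn false ^ n :=
      (generator_pow_valence hm hn true).trans (generator_pow_valence hm hn false).symm
    simp [hpow])

theorem lineAction_x : lineAction hm hn (x m n) = generator hm hn true :=
  PresentedGroup.toGroup.of _

theorem lineAction_y : lineAction hm hn (y m n) = generator hm hn false :=
  PresentedGroup.toGroup.of _

theorem circleHom_lineAction (g : Gmn m n) :
    circleHom (lineAction hm hn g) = circleAction hm hn (proj m n g) := by
  have h : circleHom.comp (lineAction hm hn) = (circleAction hm hn).comp (proj m n) := by
    refine PresentedGroup.ext fun i => ?_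
    fin_cases i
    · change circleHom (lineAction hm hn (x m n)) = circleAction hm hn (proj m n (x m n))
      rw [lineAction_x, proj_x, circleAction_letter]
    · change circleHom (lineAction hm hn (y m n)) = circleAction hm hn (proj m n (y m n))
      rw [lineAction_y, proj_y, circleAction_letter]
  exact DFunLike.congr_fun h g

/-- The standard action in which `x` and `y` act on the line by `generator`. -/
noncomputable def standardAction : StandardAction m n where
  ι := endPoint hm hn
  injective := endPoint_injective hm hn
  sbtw_of_cyc _ _ _ := sbtw_endPoint hm hn
  isClosed_range := range_endPoint hm hn ▸ Code.isClosed_range_circlePoint hm hn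
  ρ := circleAction hm hn
  sbtw_map g _ _ _ := sbtw_circleAction hm hn g
  extends_ends := circleAction_endPoint hm hn
  Θ := CircleDeg1Lift.toOrderIso.comp (lineAction hm hn)
  lift g t := by
    rw [← circleHom_lineAction]
    rfl
  central t := by
    have hpow : generator hm hn true ^ m = CircleDeg1Lift.translate (.ofAdd 1) :=
      generator_pow_valence hm hn true
    rw [MonoidHom.comp_apply, CircleDeg1Lift.coe_toOrderIso, map_pow, lineAction_x, hpow,
      CircleDeg1Lift.translate_apply, add_comm]

end Existence

end DehornoyLike

open DehornoyLike in
theorem theorem3p2_general (m n : ℕ) (hn : 2 ≤ n) (hm : 2 ≤ m) (hne : (m, n) ≠ (2, 2)) :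
    Nonempty (StandardAction m n) ∧
    IsDehornoyLike (S m n) (dehornoyLT (S m n)) ∧
    ∀ (A : StandardAction m n) (O E F : ℝ),
      (O : AddCircle (1 : ℝ)) = A.ι (Code.ones hm hn false).toEnd →
      E = A.point O 0 (Code.ones hm hn false) →
      F = A.point O 0 (Code.ones hm hn true) →
      IsLeftOrdering (ltOfPoints A.Θ ![E, F]) ∧
      ∀ g h : Gmn m n, ltOfPoints A.Θ ![E, F] g h ↔ dehornoyLT (S m n) g h := by
  have h3 : 3 ≤ m ∨ 3 ≤ n := by
    by_contra! h
    exact hne (by rw [show m = 2 by omega, show n = 2 by omega])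
  have main (A : StandardAction m n) (O : ℝ)
      (hO : (O : AddCircle (1 : ℝ)) = A.ι (Code.ones hm hn false).toEnd) :=
    A.isLeftOrdering_and_iff_dehornoyLT h3 hO
  refine ⟨⟨standardAction hm hn⟩, ⟨closure_S (by omega), ?_, ?_⟩, ?_⟩
  · obtain ⟨O, hO⟩ := QuotientAddGroup.mk_surjective
      ((standardAction hm hn).ι (Code.ones hm hn false).toEnd)
    obtain ⟨hord, hiff⟩ := main _ O hO
    rwa [funext₂ fun g h => propext (hiff g h)] at hord
  · ext g
    simp [dehornoyLT]
  · rintro A O _ _ hO rfl rfl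
    exact main A O hO

theorem theorem3p2 (m n : ℕ) (hn : 2 ≤ n) (hm : 2 ≤ m) (hmn : n ≤ m) (hne : (m, n) ≠ (2, 2)) :
    Nonempty (DehornoyLike.StandardAction m n) ∧
    DehornoyLike.IsDehornoyLike (DehornoyLike.S m n)
      (DehornoyLike.dehornoyLT (DehornoyLike.S m n)) ∧
    ∀ (A : DehornoyLike.StandardAction m n) (O E F : ℝ),
      (O : AddCircle (1 : ℝ)) = A.ι (DehornoyLike.Code.ones hm hn false).toEnd →
      E = A.point O 0 (DehornoyLike.Code.ones hm hn false) →
      F = A.point O 0 (DehornoyLike.Code.ones hm hn true) →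
      DehornoyLike.IsLeftOrdering (DehornoyLike.ltOfPoints A.Θ ![E, F]) ∧
      ∀ g h : DehornoyLike.Gmn m n,
        DehornoyLike.ltOfPoints A.Θ ![E, F] g h ↔
          DehornoyLike.dehornoyLT (DehornoyLike.S m n) g h :=
  theorem3p2_general m n hn hm hne
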